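/- Let $\Bbbk$ be an algebraically closed field of arbitrary characteristic and let $M$ be a free abelian group of rank $n$, with torus $T_M=\operatorname{Spec}\Bbbk[M]$. For a finite subset $A=\{u_0,\dots,u_N\}\subset M$ (with $u_0,\dots,u_N$ distinct), let $X_A\subset\mathbb P^N$ be the closure of the image of $\varphi_A:T_M\to\mathbb P^N$, $t\mapsto[z^{u_0}(t):\cdots:z^{u_N}(t)]$; the coordinates of $\mathbb P^N=\mathbb P^{\#A-1}$ are indexed by the elements of $A$. For a subset $S\subset M$, $\langle S-S\rangle$ denotes the subgroup generated by the differences of elements of $S$, and for a finite nonempty $S$ the torus $T_{\langle S-S\rangle}$ is the open dense orbit of $X_S$ via $t\mapsto[z^{b-b_0}(t)]_{b\in S}$ (for any fixed $b_0\in S$). Two subvarieties $X_i\subset\mathbb P^{N_i}$, $i=1,2$, are projectively equivalent if there are linear embeddings $\jmath_i:\mathbb P^{N_i}\hookrightarrow\mathbb P^{L}$ with $\jmath_1(X_1)=\jmath_2(X_2)$. The Gauss map $\gamma:X\dashrightarrow\mathbb G(n,\mathbb P^N)$ of an $n$-dimensional projective variety $X\subset\mathbb P^N$ sends each smooth point to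 the embedded tangent space there, and the Gauss defect $\delta_\gamma(X)$ is the dimension of a general fiber of $\gamma$. Assume that $A$ spans the affine lattice $M$, i.e. every element of $M$ is of the form $\sum_i a_iu_i$ with $a_i\in\mathbb Z$ and $\sum_i a_i=1$. (Then $\varphi_A$ identifies $T_M$ with a dense open subset of $X_A$ which consists of smooth points, and $\dim X_A=n$.) Set $$B:=\{u_{i_0}+\cdots+u_{i_n}\mid u_{i_0},\dots,u_{i_n}\in A\text{ span the }\Bbbk\text{-affine space }M_\Bbbk=M\otimes_{\mathbb Z}\Bbbk\},$$ and let $\pi:M\to M':=M/(\langle B-B\rangle_{\mathbb R}\cap M)$ be the natural projection, where $\langle B-B\rangle_{\mathbb R}$ is the real subspace of $M\otimes_{\mathbb Z}\mathbb R$ spanned by $B-B$. Let $\gamma:X_A\dashrightarrow\mathbb G(n,\mathbb P^N)$ be the Gauss map of $X_A$. Then $B$ is nonempty and the following hold. 1. The closure $\overline{\gamma(X_A)}$ of the image of $\gamma$, embedded in a projective space by the Plücker embedding of $\mathbb G(n,\mathbb P^N)$, is projectively equivalent to the toric variety $X_B$. 2. Under the identification $\overline{\gamma(X_A)}\cong X_B$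 given by such a projective equivalence, the restriction of $\gamma$ to $T_M\subset X_A$ is the surjective morphism $T_M\twoheadrightarrow T_{\langle B-B\rangle}\subset X_B$ induced by the inclusion $\langle B-B\rangle\subset M$. 3. Let $F\subset T_M$ be an irreducible component, with the reduced structure, of any fiber of $\gamma|_{T_M}$, and let $T_{M'}\hookrightarrow T_M$ be the subtorus induced by $\pi$. Then $F$ is a translate of $T_{M'}$ by an element of $T_M$, and the closure $\overline F\subset X_A$ is projectively equivalent to the toric variety $X_{\pi(A)}$. In particular, $\delta_\gamma(X_A)=\operatorname{rank}M'=n-\operatorname{rank}\langle B-B\rangle$. -/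

import Mathlib

open scoped LinearAlgebra.Projectivization TensorProduct Pointwise

namespace ToricGauss

noncomputable section

/-! ### Projective space over a field, with its Zariski topology -/

/-- The Zariski topology on the projective space with homogeneous coordinates indexed by `ι`:
the principal open sets `{f ≠ 0}`, `f` a homogeneous polynomial, form a basis. -/
instance zariskiProj (k : Type*) [Field k] (ι : Type*) : TopologicalSpace (ℙ k (ι → k)) :=
  TopologicalSpace.generateFrom
    {U | ∃ (d : ℕ) (f : MvPolynomial ι k), f.IsHomogeneous d ∧
      U = {x | MvPolynomial.eval x.rep f ≠ 0}}

/-- Two subsets of projective spaces are projectively equivalent if some linear embeddings of the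
two ambient spaces into a common projective space carry them to the same set. A term of this type
is such a pair of embeddings. -/
structure ProjectiveEquivalence {k : Type*} [Field k] {ι κ : Type*}
    (X : Set (ℙ k (ι → k))) (Y : Set (ℙ k (κ → k))) where
  dim : ℕ
  left : (ι → k) →ₗ[k] (Fin (dim + 1) → k)
  right : (κ → k) →ₗ[k] (Fin (dim + 1) → k)
  left_injective : Function.Injective left
  right_injective : Function.Injective right
  image_eq : Projectivization.map left left_injective '' X =
    Projectivization.map right right_injective '' Y

def ProjectivelyEquivalent {k : Type*} [Field k] {ι κ : Type*}
    (X : Set (ℙ k (ι → k))) (Y : Set (ℙ k (κ → k))) : Prop :=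
  Nonempty (ProjectiveEquivalence X Y)

/-! ### Grassmannians and the Plücker embedding -/

/-- The Grassmannian `𝔾(n, ℙ^N)` of `n`-planes in `ℙ^N`, i.e. of `(n+1)`-dimensional linear
subspaces of `k^(N+1)`. -/
def Grassmannian (k : Type*) [Field k] (n N : ℕ) : Type _ :=
  {W : Submodule k (Fin (N + 1) → k) // Module.finrank k W = n + 1}

/-- The maximal minors of the matrix with rows `v 0, …, v n`. -/
def pluckerVector {k : Type*} [Field k] {n N : ℕ} (v : Fin (n + 1) → Fin (N + 1) → k) :
    (Fin (n + 1) ↪o Fin (N + 1)) → k :=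
  fun I => Matrix.det (Matrix.of fun a b => v a (I b))

theorem pluckerVector_ne_zero {k : Type*} [Field k] {n N : ℕ}
    {v : Fin (n + 1) → Fin (N + 1) → k} (hv : LinearIndependent k v) :
    pluckerVector v ≠ 0 := by
  intro h0
  have hinj : Function.Injective (Matrix.vecMulLinear (Matrix.of v)) :=
    Matrix.vecMul_injective_iff.2 (show LinearIndependent k (Matrix.of v).row from hv)
  obtain ⟨g, hg⟩ := LinearMap.exists_leftInverse_of_injective _ (LinearMap.ker_eq_bot.2 hinj)
  -- a right inverse `w` of the matrix with rows `v`
  let w : Matrix (Fin (N + 1)) (Fin (n + 1)) k := Matrix.of fun i => g (Pi.single i 1)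
  have hw : Matrix.of v * w = 1 := by
    ext a b
    have h1 := congrFun (LinearMap.congr_fun hg (Pi.single a 1)) b
    simp only [LinearMap.comp_apply, LinearMap.id_apply, Matrix.vecMulLinear_apply,
      Matrix.single_one_vecMul] at h1
    rw [Matrix.one_eq_pi_single, ← h1, Matrix.row, show (Matrix.of v) a = v a from rfl]
    conv_rhs => rw [pi_eq_sum_univ' (v a)]
    simp [w, Matrix.mul_apply]
  have hdet : ∑ p : Fin (n + 1) → Fin (N + 1),
      (Matrix.of fun a b => v a (p b)).det * ∏ i, w (p i) i = 1 := by
    rw [← Matrix.det_one (n := Fin (n + 1)) (R := k), ← hw]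
    simp only [Matrix.det_apply', Matrix.mul_apply, Finset.prod_univ_sum, Finset.mul_sum,
      Fintype.piFinset_univ, Finset.sum_mul]
    rw [Finset.sum_comm]
    simp [Finset.prod_mul_distrib, mul_assoc]
  refine one_ne_zero (hdet.symm.trans (Finset.sum_eq_zero fun p _ => ?_))
  rw [mul_eq_zero]
  left
  by_cases hp : Function.Injective p
  · have hs : StrictMono (p ∘ Tuple.sort p) :=
      (Tuple.monotone_sort p).strictMono_of_injective (hp.comp (Tuple.sort p).injective)
    have h2 := congrFun h0 (OrderEmbedding.ofStrictMono _ hs)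
    have h3 := Matrix.det_permute' (Tuple.sort p) (Matrix.of fun a b => v a (p b))
    rw [show (Matrix.of fun a b => v a (p b)).submatrix id (Tuple.sort p) =
      Matrix.of fun a b => v a ((OrderEmbedding.ofStrictMono _ hs) b) from rfl] at h3
    rw [pluckerVector, Pi.zero_apply, h3] at h2
    refine (mul_eq_zero.1 h2).resolve_left ?_
    rcases Int.units_eq_one_or (Equiv.Perm.sign (Tuple.sort p)) with h | h <;> simp [h]
  · simp only [Function.Injective, not_forall] at hp
    obtain ⟨a, b, hab, hne⟩ := hp
    exact Matrix.det_zero_of_column_eq hne fun c => by simp [hab]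

/-- The rows: a basis of the linear subspace `W`. -/
def Grassmannian.basis {k : Type*} [Field k] {n N : ℕ} (W : Grassmannian k n N) :
    Module.Basis (Fin (n + 1)) k W.1 :=
  Module.finBasisOfFinrankEq k W.1 W.2

/-- The Plücker embedding of `𝔾(n, ℙ^N)`, in the Plücker coordinates indexed by
`i₀ < ⋯ < iₙ`. (Another basis of `W` multiplies all of them by one nonzero scalar.) -/
def plucker {k : Type*} [Field k] {n N : ℕ} (W : Grassmannian k n N) :
    ℙ k ((Fin (n + 1) ↪o Fin (N + 1)) → k) :=
  Projectivization.mk k (pluckerVector fun a => (W.basis a : Fin (N + 1) → k))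
    (pluckerVector_ne_zero
      (W.basis.linearIndependent.map' W.1.subtype (Submodule.ker_subtype _)))

/-! ### Smooth points and the Gauss map -/

/-- The linear subspace of `k^(N+1)` whose projectivization is the embedded tangent space of `X`
at `x`: it is cut out by the differentials at `x` of the homogeneous polynomials that vanish
on `X`. -/
def embeddedTangentSpace {k : Type*} [Field k] {N : ℕ} (X : Set (ℙ k (Fin (N + 1) → k)))
    (x : ℙ k (Fin (N + 1) → k)) : Submodule k (Fin (N + 1) → k) where
  carrier := {v | ∀ (d : ℕ) (f : MvPolynomial (Fin (N + 1)) k), f.IsHomogeneous d →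
    (∀ y ∈ X, MvPolynomial.eval y.rep f = 0) →
    ∑ i, MvPolynomial.eval x.rep (MvPolynomial.pderiv i f) * v i = 0}
  add_mem' {v w} hv hw d f hf hX := by
    simp only [Pi.add_apply, mul_add, Finset.sum_add_distrib, hv d f hf hX, hw d f hf hX, add_zero]
  zero_mem' d f hf hX := by simp
  smul_mem' c v hv d f hf hX := by
    have h : ∑ i, MvPolynomial.eval x.rep (MvPolynomial.pderiv i f) * (c • v) i =
        c * ∑ i, MvPolynomial.eval x.rep (MvPolynomial.pderiv i f) * v i := by
      rw [Finset.mul_sum]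
      exact Finset.sum_congr rfl fun i _ => by simp only [Pi.smul_apply, smul_eq_mul]; ring
    rw [h, hv d f hf hX, mul_zero]

/-- The smooth points of a projective variety `X`: the points at which the embedded tangent
space has (projective) dimension `dim X`. -/
def smoothLocus {k : Type*} [Field k] {N : ℕ} (X : Set (ℙ k (Fin (N + 1) → k))) :
    Set (ℙ k (Fin (N + 1) → k)) :=
  {x | x ∈ X ∧ (Module.finrank k (embeddedTangentSpace X x) : WithBot ℕ∞) =
    topologicalKrullDim X + 1}

/-- The Gauss map of an `n`-dimensional projective variety `X ⊆ ℙ^N`, which sends a smooth point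
to the embedded tangent space there. -/
def gaussMap {k : Type*} [Field k] {N : ℕ} (X : Set (ℙ k (Fin (N + 1) → k))) {n : ℕ}
    (hX : topologicalKrullDim X = n) (x : smoothLocus X) : Grassmannian k n N :=
  ⟨embeddedTangentSpace X x.1, by have h := x.2.2; rw [hX] at h; exact_mod_cast h⟩

/-- The closure of the image of the Gauss map, inside the Plücker space. -/
def gaussImage {k : Type*} [Field k] {N : ℕ} (X : Set (ℙ k (Fin (N + 1) → k))) {n : ℕ}
    (hX : topologicalKrullDim X = n) : Set (ℙ k ((Fin (n + 1) ↪o Fin (N + 1)) → k)) :=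
  closure (Set.range fun x : smoothLocus X => plucker (gaussMap X hX x))

/-- `δ` is the dimension of a general fiber of the Gauss map of `X`: for all points `x` of
some dense open subset of `X`, `x` is smooth and the fiber through `x` has dimension `δ`. -/
def IsGaussDefect {k : Type*} [Field k] {N : ℕ} (X : Set (ℙ k (Fin (N + 1) → k))) {n : ℕ}
    (hX : topologicalKrullDim X = n) (δ : ℕ) : Prop :=
  ∃ U : Set (ℙ k (Fin (N + 1) → k)), IsOpen U ∧ X ⊆ closure (X ∩ U) ∧
    ∀ x ∈ X ∩ U, ∃ hx : x ∈ smoothLocus X,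
      topologicalKrullDim {y : smoothLocus X | gaussMap X hX y = gaussMap X hX ⟨x, hx⟩} = δ

/-! ### Tori and toric varieties -/

/-- The torus `T_M = Spec k[M]`, through its `k`-points: the characters `M → kˣ`. It is a group
under pointwise multiplication. -/
abbrev Torus (k M : Type*) [Field k] [AddCommGroup M] : Type _ := Multiplicative M →* kˣ

/-- The monomial `z^u` as a function on `T_M`. -/
def Torus.monomial {k M : Type*} [Field k] [AddCommGroup M] (u : M) (t : Torus k M) : k :=
  (t (Multiplicative.ofAdd u) : kˣ)

/-- The value of the regular function `f ∈ k[M]` at a point of `T_M`. -/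
def Torus.eval {k M : Type*} [Field k] [AddCommGroup M] (f : AddMonoidAlgebra k M)
    (t : Torus k M) : k :=
  Finsupp.sum f.coeff fun u c => c * Torus.monomial u t

/-- The Zariski topology on `T_M`: the principal open sets `{f ≠ 0}`, `f ∈ k[M]`,
form a basis. -/
instance zariskiTorus (k M : Type*) [Field k] [AddCommGroup M] : TopologicalSpace (Torus k M) :=
  TopologicalSpace.generateFrom
    {U | ∃ f : AddMonoidAlgebra k M, U = {t | Torus.eval f t ≠ 0}}

/-- The morphism `T_{M₂} → T_{M₁}` induced by a homomorphism `M₁ → M₂`. -/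
def Torus.induced (k : Type*) [Field k] {M₁ M₂ : Type*} [AddCommGroup M₁] [AddCommGroup M₂]
    (f : M₁ →+ M₂) : Torus k M₂ →* Torus k M₁ :=
  MonoidHom.compHom' (AddMonoidHom.toMultiplicative f)

/-- The morphism `φ_A : T_M → ℙ^N, t ↦ [z^{u_0}(t) : ⋯ : z^{u_N}(t)]`. -/
def torusMap (k : Type*) [Field k] {M ι : Type*} [AddCommGroup M] [Nonempty ι] (u : ι → M)
    (t : Torus k M) : ℙ k (ι → k) :=
  Projectivization.mk k (fun i => Torus.monomial (u i) t)
    (fun h => (t (Multiplicative.ofAdd (u (Classical.arbitrary ι)))).ne_zero (congrFun h _))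

/-- The toric variety `X_A ⊆ ℙ^N` of a family `A = (u_i)` of points of `M`. -/
def toricVariety (k : Type*) [Field k] {M ι : Type*} [AddCommGroup M] [Nonempty ι]
    (u : ι → M) : Set (ℙ k (ι → k)) :=
  closure (Set.range (torusMap k u))

/-- The toric variety `X_S ⊆ ℙ^(#S - 1)` of a set `S` of points of `M`, its homogeneous
coordinates being indexed by the elements of `S`. -/
abbrev toricVarietyOfSet (k : Type*) [Field k] {M : Type*} [AddCommGroup M] (S : Set M)
    [Nonempty S] : Set (ℙ k (S → k)) :=
  toricVariety k (Subtype.val : S → M)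

/-- The subgroup `⟨S - S⟩` of `M`. -/
def diffLattice {M : Type*} [AddCommGroup M] (S : Set M) : AddSubgroup M :=
  AddSubgroup.closure (S - S)

/-- The inclusion of `T_{⟨S - S⟩}` in `X_S` as its open dense orbit:
`t ↦ [z^{b - b₀}(t)]_{b ∈ S}`. It does not depend on the choice of `b₀ ∈ S`. -/
def orbitMap (k : Type*) [Field k] {M : Type*} [AddCommGroup M] (S : Set M) (b₀ : S)
    (t : Torus k (diffLattice S)) : ℙ k (S → k) :=
  Projectivization.mk k
    (fun b => Torus.monomial (⟨b.1 - b₀.1,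
      AddSubgroup.subset_closure (Set.sub_mem_sub b.2 b₀.2)⟩ : diffLattice S) t)
    (fun h => (t (Multiplicative.ofAdd _)).ne_zero (congrFun h b₀))

/-- `φ` identifies the space `T` with a dense open subset of `X`. -/
def IsDenseOpenIn {T P : Type*} [TopologicalSpace T] [TopologicalSpace P] (φ : T → P)
    (X : Set P) : Prop :=
  Topology.IsEmbedding φ ∧ (∃ U : Set P, IsOpen U ∧ Set.range φ = X ∩ U) ∧
    X ⊆ closure (Set.range φ)

/-- The set `B` of the sums `u_{i_0} + ⋯ + u_{i_n}` such that `u_{i_0}, …, u_{i_n}` span the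
`k`-affine space `M_k = k ⊗ M`. -/
def spanningSums (k : Type*) [Field k] {M ι : Type*} [AddCommGroup M] (u : ι → M) (n : ℕ) :
    Set M :=
  {b | ∃ i : Fin (n + 1) → ι,
    affineSpan k (Set.range fun j => (1 : k) ⊗ₜ[ℤ] u (i j)) = ⊤ ∧ b = ∑ j, u (i j)}

/-- The subgroup `⟨S - S⟩_ℝ ∩ M` of `M`, where `⟨S - S⟩_ℝ` is the real subspace of `ℝ ⊗ M`
spanned by `S - S`. -/
def realSaturation {M : Type*} [AddCommGroup M] (S : Set M) : AddSubgroup M :=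
  (Submodule.span ℝ ((fun m : M => (1 : ℝ) ⊗ₜ[ℤ] m) '' (S - S))).toAddSubgroup.comap
    (TensorProduct.mk ℤ ℝ M 1).toAddMonoidHom

end

end ToricGauss

open ToricGauss

/-! On the torus, the logarithmic derivatives of the parametrization `t ↦ (z^{u_j}(t))_j` show that
the embedded tangent space at `φ_A(t)` is the row space of the matrix with columns `z^{u_j}(t) · (1,
u_j)`, the `u_j` being written in a basis of `M` (`embeddedTangentSpace_torusMap`). One inclusion is
Euler's formula and the chain rule; the other uses only the binomial equations of `X_A`. Both work
in every characteristic, because the `u_j` span the affine lattice over ℤ.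

The maximal minor of this matrix on the columns `I` is `z^{∑ u_i}(t)` times the constant `det (1,
u_i)_{i ∈ I}` (`pluckerVector_tangentRows`), and the constant is nonzero in `k` exactly when the
`u_i` span `M_k` (`affineSpan_eq_top_iff`). So in Plücker coordinates `γ` is `t ↦ [z^b(t)]_{b ∈ B}`,
with coordinates repeated, rescaled and padded by zeros: a linear embedding of the torus map of `B`.
Taking closures gives (1) and (2). Smooth points outside the torus add nothing to the closure, since
the Gauss map is locally polynomial (`plucker_gaussMap_mem_closure`).

The fibers on `T_M` are thus cosets of the kernel of `T_M → T_{⟨B-B⟩}`. As `⟨B-B⟩` has finite index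
in its saturation, this kernel is a finite union of translates of the irreducible group `T_{M'}`
(`exists_finite_cosets`), and these are the components. On a translate, `z^{u_i}` is a constant
times the character `π(u_i)`, which identifies the closure with `X_{π(A)}`.

Krull dimensions are bounded below by flags of subtori and above by Noether normalization in an
affine chart, whose coordinate ring embeds in a Laurent polynomial ring. The fiber in the definition
of the defect may also meet the boundary of `X_A`. Its points are grouped by their finitely many
supports; two points with one support differ by a torus element that is trivial on `⟨B-B⟩`, so the
boundary does not raise the dimension. -/

namespace ToricGauss

noncomputable section

/-! ### The Zariski topology of projective space -/

section Proj

variable {k : Type*} [Field k] {ι κ : Type*}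

theorem eval_smul_of_isHomogeneous {f : MvPolynomial ι k} {d : ℕ} (hf : f.IsHomogeneous d)
    (c : k) (x : ι → k) : MvPolynomial.eval (c • x) f = c ^ d * MvPolynomial.eval x f := by
  rw [MvPolynomial.eval_eq, MvPolynomial.eval_eq, Finset.mul_sum]
  refine Finset.sum_congr rfl fun a ha => ?_
  have h : a.degree = d := by
    rw [Finsupp.degree_eq_weight_one]
    exact hf (MvPolynomial.mem_support_iff.1 ha)
  simp only [Pi.smul_apply, smul_eq_mul, mul_pow, Finset.prod_mul_distrib,
    Finset.prod_pow_eq_pow_sum]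
  rw [show ∑ i ∈ a.support, a i = d from h]
  ring

theorem eval_rep_mk_eq_zero {f : MvPolynomial ι k} {d : ℕ} (hf : f.IsHomogeneous d)
    {v : ι → k} (hv : v ≠ 0) :
    MvPolynomial.eval (Projectivization.mk k v hv).rep f = 0 ↔ MvPolynomial.eval v f = 0 := by
  obtain ⟨a, ha⟩ := Projectivization.exists_smul_eq_mk_rep k v hv
  rw [← ha, Units.smul_def, eval_smul_of_isHomogeneous hf]
  simp

theorem isTopologicalBasis_zariskiProj :
    TopologicalSpace.IsTopologicalBasis
      {U : Set (ℙ k (ι → k)) | ∃ (d : ℕ) (f : MvPolynomial ι k), f.IsHomogeneous d ∧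
        U = {x | MvPolynomial.eval x.rep f ≠ 0}} where
  exists_subset_inter := by
    rintro _ ⟨d, f, hf, rfl⟩ _ ⟨e, g, hg, rfl⟩ x hx
    refine ⟨_, ⟨d + e, f * g, hf.mul hg, rfl⟩, ?_, ?_⟩
    · simpa using hx
    · intro y hy
      simpa using hy
  sUnion_eq := by
    refine Set.eq_univ_of_forall fun x => ⟨_, ⟨0, 1, MvPolynomial.isHomogeneous_one _ _, rfl⟩, ?_⟩
    simp
  eq_generateFrom := rfl

theorem isOpen_eval_ne_zero {f : MvPolynomial ι k} {d : ℕ} (hf : f.IsHomogeneous d) :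
    IsOpen {x : ℙ k (ι → k) | MvPolynomial.eval x.rep f ≠ 0} :=
  isTopologicalBasis_zariskiProj.isOpen ⟨d, f, hf, rfl⟩

theorem isOpen_rep_ne_zero (i : ι) : IsOpen {x : ℙ k (ι → k) | x.rep i ≠ 0} := by
  simpa using isOpen_eval_ne_zero (MvPolynomial.isHomogeneous_X k i)

theorem mem_closure_iff_eval {Y : Set (ℙ k (ι → k))} {y : ℙ k (ι → k)} :
    y ∈ closure Y ↔ ∀ (d : ℕ) (f : MvPolynomial ι k), f.IsHomogeneous d →
      (∀ x ∈ Y, MvPolynomial.eval x.rep f = 0) → MvPolynomial.eval y.rep f = 0 := by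
  rw [isTopologicalBasis_zariskiProj.mem_closure_iff]
  constructor
  · intro h d f hf hY
    by_contra hy
    obtain ⟨x, hx, hxY⟩ := h _ ⟨d, f, hf, rfl⟩ hy
    exact hx (hY x hxY)
  · rintro h _ ⟨d, f, hf, rfl⟩ hy
    by_contra hne
    refine hy (h d f hf fun x hx => ?_)
    by_contra hx0
    exact hne ⟨x, hx0, hx⟩

/-- A polynomial that vanishes on the cone over a set vanishes on the cone over its closure. -/
theorem eval_rep_eq_zero_of_mem_closure [Infinite k] {Y : Set (ℙ k (ι → k))}
    {y : ℙ k (ι → k)} (hy : y ∈ closure Y) (f : MvPolynomial ι k)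
    (hf : ∀ x ∈ Y, ∀ c : k, c ≠ 0 → MvPolynomial.eval (c • x.rep) f = 0) :
    MvPolynomial.eval y.rep f = 0 := by
  have key : ∀ x ∈ Y, ∀ d,
      MvPolynomial.eval x.rep (MvPolynomial.homogeneousComponent d f) = 0 := by
    intro x hx
    -- As a polynomial in the scalar `c`, this is `f(c x)`. It vanishes at every nonzero `c` in an
    -- infinite field, so each homogeneous component of `f` vanishes at `x`.
    let p : Polynomial k := ∑ d ∈ Finset.range (f.totalDegree + 1),
      Polynomial.monomial d (MvPolynomial.eval x.rep (MvPolynomial.homogeneousComponent d f))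
    have hp : p = 0 := by
      refine Polynomial.eq_zero_of_infinite_isRoot p
        ((Set.finite_singleton (0 : k)).infinite_compl.mono fun c hc => ?_)
      have h1 := hf x hx c hc
      rw [← MvPolynomial.sum_homogeneousComponent f, map_sum] at h1
      rw [Set.mem_ofPred_eq, Polynomial.IsRoot, Polynomial.eval_finsetSum, ← h1]
      refine Finset.sum_congr rfl fun d _ => ?_
      rw [Polynomial.eval_monomial, eval_smul_of_isHomogeneous
        (MvPolynomial.homogeneousComponent_isHomogeneous d f), mul_comm]
    intro d
    by_cases hd : d < f.totalDegree + 1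
    · have h2 := congrArg (fun q => Polynomial.coeff q d) hp
      simpa [p, Polynomial.finsetSum_coeff, Polynomial.coeff_monomial, Nat.lt_succ_iff.1 hd,
        Nat.lt_succ_iff] using h2
    · rw [MvPolynomial.homogeneousComponent_eq_zero _ _ (by omega), map_zero]
  rw [← MvPolynomial.sum_homogeneousComponent f, map_sum]
  exact Finset.sum_eq_zero fun d _ => mem_closure_iff_eval.1 hy d _
    (MvPolynomial.homogeneousComponent_isHomogeneous d f) fun x hx => key x hx d

/-- Substitution of linear forms. -/
def linearSubst [Fintype ι] [DecidableEq ι] (R : (ι → k) →ₗ[k] (κ → k)) (f : MvPolynomial κ k) :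
    MvPolynomial ι k :=
  MvPolynomial.aeval
    (fun j => ∑ i, MvPolynomial.C (R (Pi.single i 1) j) * MvPolynomial.X i) f

variable [Fintype ι] [DecidableEq ι]

theorem eval_linearSubst (R : (ι → k) →ₗ[k] (κ → k)) (f : MvPolynomial κ k) (x : ι → k) :
    MvPolynomial.eval x (linearSubst R f) = MvPolynomial.eval (R x) f := by
  rw [linearSubst, MvPolynomial.aeval_def, MvPolynomial.eval_eval₂]
  rw [← MvPolynomial.eval₂_id]
  congr 1
  · ext; simp
  · funext j
    conv_rhs => rw [pi_eq_sum_univ' x]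
    simp [mul_comm]

theorem linearSubst_isHomogeneous (R : (ι → k) →ₗ[k] (κ → k)) {f : MvPolynomial κ k} {d : ℕ}
    (hf : f.IsHomogeneous d) : (linearSubst R f).IsHomogeneous d := by
  have := hf.aeval (fun j => ∑ i, MvPolynomial.C (R (Pi.single i 1) j) * MvPolynomial.X i)
    (n := 1) (fun j => MvPolynomial.IsHomogeneous.sum _ _ _ fun i _ => by
      simpa using (MvPolynomial.isHomogeneous_C ι (R (Pi.single i 1) j)).mul
        (MvPolynomial.isHomogeneous_X k i))
  simpa [linearSubst] using this

theorem eval_rep_map_eq_zero (R : (ι → k) →ₗ[k] (κ → k)) (hR : Function.Injective R)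
    {f : MvPolynomial κ k} {d : ℕ} (hf : f.IsHomogeneous d) (x : ℙ k (ι → k)) :
    MvPolynomial.eval (Projectivization.map R hR x).rep f = 0 ↔
      MvPolynomial.eval x.rep (linearSubst R f) = 0 := by
  rw [eval_linearSubst]
  conv_lhs => rw [← x.mk_rep, Projectivization.map_mk]
  exact eval_rep_mk_eq_zero hf _

/-- With a linear left inverse `g` of `R`, the linear forms `R ∘ g - id` cut out the image of `R`,
so the closure stays inside the image. Homogeneous equations are then transported in both directions
by substituting `R` or `g`. -/
theorem closure_map_image [Fintype κ] [DecidableEq κ] (R : (ι → k) →ₗ[k] (κ → k))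
    (hR : Function.Injective R) (Y : Set (ℙ k (ι → k))) :
    closure (Projectivization.map R hR '' Y) = Projectivization.map R hR '' closure Y := by
  obtain ⟨g, hg⟩ := LinearMap.exists_leftInverse_of_injective _ (LinearMap.ker_eq_bot.2 hR)
  have hg' : ∀ x, g (R x) = x := LinearMap.congr_fun hg
  ext y
  constructor
  · intro hy
    have hrange : R (g y.rep) = y.rep := by
      funext j
      have h1 := mem_closure_iff_eval.1 hy 1
        (linearSubst (R.comp g - LinearMap.id) (MvPolynomial.X j))
        (linearSubst_isHomogeneous _ (MvPolynomial.isHomogeneous_X k j)) (by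
          rintro _ ⟨x, hx, rfl⟩
          rw [eval_rep_map_eq_zero _ _
            (linearSubst_isHomogeneous _ (MvPolynomial.isHomogeneous_X k j)),
            eval_linearSubst, eval_linearSubst]
          simp [hg'])
      rw [eval_linearSubst] at h1
      simpa [sub_eq_zero] using h1
    have hne : g y.rep ≠ 0 := fun h0 => y.rep_nonzero (by rw [← hrange, h0, map_zero])
    refine ⟨Projectivization.mk k _ hne, ?_, ?_⟩
    · refine mem_closure_iff_eval.2 fun d f hf hY => ?_
      rw [eval_rep_mk_eq_zero hf, ← eval_linearSubst]
      refine mem_closure_iff_eval.1 hy d _ (linearSubst_isHomogeneous g hf) ?_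
      rintro _ ⟨x, hx, rfl⟩
      rw [eval_rep_map_eq_zero _ _ (linearSubst_isHomogeneous g hf), eval_linearSubst,
        eval_linearSubst, hg']
      exact hY x hx
    · rw [Projectivization.map_mk]
      simp only [hrange, Projectivization.mk_rep]
  · rintro ⟨x, hx, rfl⟩
    refine mem_closure_iff_eval.2 fun d f hf hY => ?_
    rw [eval_rep_map_eq_zero _ _ hf]
    refine mem_closure_iff_eval.1 hx d _ (linearSubst_isHomogeneous R hf) fun z hz => ?_
    rw [← eval_rep_map_eq_zero _ hR hf]
    exact hY _ ⟨z, hz, rfl⟩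

end Proj

/-! ### Tori -/

section TorusBasics

variable {k : Type*} [Field k] {M M₁ M₂ : Type*} [AddCommGroup M] [AddCommGroup M₁]
  [AddCommGroup M₂]

namespace Torus

theorem monomial_ne_zero (u : M) (t : Torus k M) : monomial u t ≠ 0 :=
  (t (Multiplicative.ofAdd u)).ne_zero

theorem monomial_add (u v : M) (t : Torus k M) :
    monomial (u + v) t = monomial u t * monomial v t := by
  simp [monomial]

@[simp] theorem monomial_zero (t : Torus k M) : monomial 0 t = 1 := by
  simp [monomial]

theorem monomial_nsmul (a : ℕ) (u : M) (t : Torus k M) :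
    monomial (a • u) t = monomial u t ^ a := by
  simp [monomial]

theorem monomial_zsmul (a : ℤ) (u : M) (t : Torus k M) :
    monomial (a • u) t = monomial u t ^ a := by
  simp [monomial]

theorem monomial_neg (u : M) (t : Torus k M) : monomial (-u) t = (monomial u t)⁻¹ := by
  simp [monomial]

theorem monomial_sub (u v : M) (t : Torus k M) :
    monomial (u - v) t = monomial u t / monomial v t := by
  simp [monomial]

theorem monomial_sum {ι : Type*} (s : Finset ι) (u : ι → M) (t : Torus k M) :
    monomial (∑ i ∈ s, u i) t = ∏ i ∈ s, monomial (u i) t := by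
  classical
  induction s using Finset.induction_on with
  | empty => simp
  | insert a s ha ih => rw [Finset.sum_insert ha, Finset.prod_insert ha, monomial_add, ih]

theorem monomial_mul (u : M) (s t : Torus k M) :
    monomial u (s * t) = monomial u s * monomial u t := by
  simp [monomial]

@[simp] theorem monomial_one (u : M) : monomial u (1 : Torus k M) = 1 := by
  simp [monomial]

theorem monomial_inv (u : M) (t : Torus k M) : monomial u t⁻¹ = (monomial u t)⁻¹ := by
  simp [monomial]

theorem monomial_induced (f : M₁ →+ M₂) (u : M₁) (t : Torus k M₂) :
    monomial u (induced k f t) = monomial (f u) t := rfl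

theorem ext_monomial {s t : Torus k M} (h : ∀ u, monomial u s = monomial u t) : s = t :=
  MonoidHom.ext fun u => Units.ext (h u.toAdd)

/-- Evaluation at a point of the torus, as a homomorphism of algebras. -/
def evalHom (t : Torus k M) : AddMonoidAlgebra k M →ₐ[k] k :=
  AddMonoidAlgebra.lift k k M ((Units.coeHom k).comp t)

theorem evalHom_apply (f : AddMonoidAlgebra k M) (t : Torus k M) : evalHom t f = eval f t := by
  simp [evalHom, AddMonoidAlgebra.lift_apply, eval, monomial]

theorem eval_mul (f g : AddMonoidAlgebra k M) (t : Torus k M) :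
    eval (f * g) t = eval f t * eval g t := by
  simp only [← evalHom_apply, map_mul]

theorem eval_single (u : M) (c : k) (t : Torus k M) :
    eval (AddMonoidAlgebra.single u c) t = c * monomial u t := by
  simp [eval]

theorem isTopologicalBasis : TopologicalSpace.IsTopologicalBasis
    {U : Set (Torus k M) | ∃ f : AddMonoidAlgebra k M, U = {t | eval f t ≠ 0}} where
  exists_subset_inter := by
    rintro _ ⟨f, rfl⟩ _ ⟨g, rfl⟩ x hx
    refine ⟨_, ⟨f * g, rfl⟩, ?_, ?_⟩
    · simpa [eval_mul] using hx
    · intro y hy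
      simpa [eval_mul] using hy
  sUnion_eq := by
    refine Set.eq_univ_of_forall fun x => ⟨_, ⟨1, rfl⟩, ?_⟩
    simp [← evalHom_apply]
  eq_generateFrom := rfl

theorem isOpen_eval_ne_zero (f : AddMonoidAlgebra k M) : IsOpen {t | eval f t ≠ 0} :=
  isTopologicalBasis.isOpen ⟨f, rfl⟩

theorem isClosed_monomial_eq (u v : M) : IsClosed {t : Torus k M | monomial u t = monomial v t} := by
  have h := isOpen_eval_ne_zero
    (AddMonoidAlgebra.single u (1 : k) - AddMonoidAlgebra.single v 1)
  rw [← isOpen_compl_iff]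
  convert h using 1
  ext t
  simp [← evalHom_apply, sub_eq_zero]
  simp [evalHom_apply, eval_single]

theorem isClosed_monomial_eq_const (u : M) (c : k) :
    IsClosed {t : Torus k M | monomial u t = c} := by
  have h := isOpen_eval_ne_zero
    (AddMonoidAlgebra.single u (1 : k) - AddMonoidAlgebra.single 0 c)
  rw [← isOpen_compl_iff]
  convert h using 1
  ext t
  simp [← evalHom_apply, sub_eq_zero]
  simp [evalHom_apply, eval_single]

theorem continuous_induced (f : M₁ →+ M₂) : Continuous (induced k f) := by
  refine isTopologicalBasis.continuous_iff.2 ?_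
  rintro _ ⟨g, rfl⟩
  have h := isOpen_eval_ne_zero (AddMonoidAlgebra.mapDomainAlgHom k k f g)
  convert h using 1
  ext t
  have : (evalHom t).comp (AddMonoidAlgebra.mapDomainAlgHom k k f) = evalHom (induced k f t) := by
    refine AddMonoidAlgebra.algHom_ext (fun u => ?_) (Subsingleton.elim _ _)
    simp [evalHom_apply, eval_single, monomial_induced]
  have h2 := DFunLike.congr_fun this g
  simp only [AlgHom.comp_apply, evalHom_apply] at h2
  rw [Set.mem_preimage, Set.mem_ofPred_eq, Set.mem_ofPred_eq, h2]

theorem continuous_mul_left (s : Torus k M) : Continuous (fun t => s * t) := by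
  refine isTopologicalBasis.continuous_iff.2 ?_
  rintro _ ⟨g, rfl⟩
  let e : AddMonoidAlgebra k M →ₐ[k] AddMonoidAlgebra k M := AddMonoidAlgebra.lift k _ M
    { toFun := fun u => AddMonoidAlgebra.single u.toAdd (monomial u.toAdd s)
      map_one' := by simp [AddMonoidAlgebra.one_def]
      map_mul' := fun u v => by
        simp [AddMonoidAlgebra.single_mul_single, monomial_add] }
  have h := isOpen_eval_ne_zero (e g)
  convert h using 1
  ext t
  have : (evalHom t).comp e = evalHom (s * t) := by
    refine AddMonoidAlgebra.algHom_ext (fun u => ?_) (Subsingleton.elim _ _)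
    simp [evalHom_apply, eval_single, e, monomial_mul]
  have h2 := DFunLike.congr_fun this g
  simp only [AlgHom.comp_apply, evalHom_apply] at h2
  rw [Set.mem_preimage, Set.mem_ofPred_eq, Set.mem_ofPred_eq, h2]

/-- The point of a torus with prescribed coordinates in a basis of the lattice. -/
def ofBasis {ι : Type*} [Fintype ι] (b : Module.Basis ι ℤ M) (a : ι → kˣ) : Torus k M :=
  AddMonoidHom.toMultiplicativeLeft
    ((b.constr ℤ fun i => Additive.ofMul (a i)) : M →ₗ[ℤ] Additive kˣ).toAddMonoidHom

theorem monomial_ofBasis {ι : Type*} [Fintype ι] (b : Module.Basis ι ℤ M) (a : ι → kˣ) (u : M) :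
    monomial u (ofBasis b a) = ∏ i, (a i : k) ^ (b.repr u i) := by
  simp [monomial, ofBasis, Module.Basis.constr_apply_fintype]

/-- If two exponents differed in some coordinate, every element of `kˣ` would be a root of unity of
one fixed order, which an infinite field excludes. -/
theorem monomial_injective [Infinite k] [Module.Free ℤ M] [Module.Finite ℤ M] {u v : M}
    (h : ∀ t : Torus k M, monomial u t = monomial v t) : u = v := by
  classical
  let b := Module.Free.chooseBasis ℤ M
  refine b.repr.injective (Finsupp.ext fun i => ?_)
  by_contra hne
  have key : ∀ a : kˣ, (a : k) ^ (b.repr u i) = (a : k) ^ (b.repr v i) := by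
    intro a
    have h1 := h (ofBasis b (Pi.mulSingle i a))
    rw [monomial_ofBasis, monomial_ofBasis, Finset.prod_eq_single i, Finset.prod_eq_single i] at h1
    · simpa using h1
    all_goals simp +contextual
  obtain ⟨d, hd, hd'⟩ : ∃ d : ℕ, 0 < d ∧ ∀ a : kˣ, (a : k) ^ d = 1 := by
    refine ⟨(b.repr u i - b.repr v i).natAbs, by omega, fun a => ?_⟩
    have h2 : (a : k) ^ (b.repr u i - b.repr v i) = 1 := by
      rw [zpow_sub₀ a.ne_zero, key, div_self (zpow_ne_zero _ a.ne_zero)]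
    rcases Int.natAbs_eq (b.repr u i - b.repr v i) with h3 | h3
    · rw [h3] at h2; exact_mod_cast h2
    · rw [h3, zpow_neg, inv_eq_one] at h2; exact_mod_cast h2
  have : (Polynomial.X ^ d - 1 : Polynomial k) = 0 := by
    refine Polynomial.eq_zero_of_infinite_isRoot _
      ((Set.finite_singleton (0 : k)).infinite_compl.mono fun c hc => ?_)
    have h4 : c ^ d = 1 := hd' (Units.mk0 c hc)
    simp [h4]
  exact Polynomial.X_pow_sub_C_ne_zero hd (1 : k) (by simpa using this)

/-- Distinct lattice points give distinct characters of the group `T_M`, and distinct characters are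
linearly independent (Dedekind). -/
theorem eq_zero_of_eval_eq_zero [Infinite k] [Module.Free ℤ M] [Module.Finite ℤ M]
    {f : AddMonoidAlgebra k M} (h : ∀ t, eval f t = 0) : f = 0 := by
  let χ : M → (Torus k M →* k) := fun u =>
    { toFun := monomial u
      map_one' := monomial_one u
      map_mul' := monomial_mul u }
  have hχ : Function.Injective χ := fun u v huv =>
    monomial_injective fun t => DFunLike.congr_fun huv t
  have hli := (linearIndependent_monoidHom (Torus k M) k).comp χ hχ
  rw [linearIndependent_iff] at hli
  refine AddMonoidAlgebra.coeff_eq_zero.1 (hli f.coeff ?_)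
  funext t
  simpa [Finsupp.linearCombination_apply, Finsupp.sum, eval, χ] using h t

theorem isDomain_addMonoidAlgebra [Module.Free ℤ M] : IsDomain (AddMonoidAlgebra k M) := by
  have : UniqueSums M := UniqueSums.of_injective_addHom
    ((Module.Free.chooseBasis ℤ M).repr.toLinearMap.toAddMonoidHom : M →+ _).toAddHom
    (Module.Free.chooseBasis ℤ M).repr.injective inferInstance
  infer_instance

theorem isIrreducible_univ [Infinite k] [Module.Free ℤ M] [Module.Finite ℤ M] :
    IsIrreducible (Set.univ : Set (Torus k M)) := by
  refine ⟨⟨1, trivial⟩, ?_⟩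
  intro U V hU hV ⟨x, _, hx⟩ ⟨y, _, hy⟩
  obtain ⟨_, ⟨f, rfl⟩, hxf, hfU⟩ := isTopologicalBasis.exists_subset_of_mem_open hx hU
  obtain ⟨_, ⟨g, rfl⟩, hyg, hgV⟩ := isTopologicalBasis.exists_subset_of_mem_open hy hV
  have := isDomain_addMonoidAlgebra (k := k) (M := M)
  have hfg : f * g ≠ 0 := mul_ne_zero
    (by rintro rfl; exact hxf (by simp [← evalHom_apply]))
    (by rintro rfl; exact hyg (by simp [← evalHom_apply]))
  by_contra hne
  refine hfg (eq_zero_of_eval_eq_zero fun t => ?_)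
  by_contra ht
  rw [eval_mul] at ht
  exact hne ⟨t, trivial, hfU (left_ne_zero_of_mul ht), hgV (right_ne_zero_of_mul ht)⟩

end Torus

/-- A character of `G` that is trivial on the kernel of `f : G → H` extends to `H`, because the
multiplicative group of an algebraically closed field is divisible. -/
theorem exists_torus_comp_eq [IsAlgClosed k] (f : M₁ →+ M₂) (s : Torus k M₁)
    (h : ∀ m, f m = 0 → Torus.monomial m s = 1) : ∃ t : Torus k M₂, Torus.induced k f t = s := by
  let : DivisibleBy (Additive kˣ) ℕ := by
    refine divisibleByOfSMulRightSurj (Additive kˣ) ℕ ?_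
    intro d hd x
    obtain ⟨z, hz⟩ := IsAlgClosed.exists_pow_nat_eq ((x.toMul : kˣ) : k) (Nat.pos_of_ne_zero hd)
    have hz0 : z ≠ 0 := by
      rintro rfl
      rw [zero_pow hd] at hz
      exact x.toMul.ne_zero hz.symm
    refine ⟨Additive.ofMul (Units.mk0 z hz0), ?_⟩
    apply Additive.toMul.injective
    ext
    simpa using hz
  let : DivisibleBy (Additive kˣ) ℤ := AddGroup.divisibleByIntOfDivisibleByNat (Additive kˣ)
  let s' : M₁ →+ Additive kˣ := MonoidHom.toAdditiveRight s
  have hs' : f.ker ≤ s'.ker := fun m hm => by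
    have h1 := h m hm
    apply Additive.toMul.injective
    exact Units.ext h1
  obtain ⟨g, hg⟩ := (Module.Baer.of_divisible (Additive kˣ)).extension_property_addMonoidHom
    (QuotientAddGroup.kerLift f) (QuotientAddGroup.kerLift_injective f)
    (QuotientAddGroup.lift f.ker s' hs')
  refine ⟨AddMonoidHom.toMultiplicativeLeft g, Torus.ext_monomial fun m => ?_⟩
  have h2 := DFunLike.congr_fun hg (QuotientAddGroup.mk m)
  exact congrArg (fun x : Additive kˣ => ((Additive.toMul x : kˣ) : k)) h2

end TorusBasics

/-! ### Toric varieties -/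

section Toric

variable {k : Type*} [Field k] {L ι : Type*} [AddCommGroup L]

/-- The substitution `x_i ↦ c_i z^{v_i}`. -/
def monomialSubst (c : ι → k) (v : ι → L) : MvPolynomial ι k →ₐ[k] AddMonoidAlgebra k L :=
  MvPolynomial.aeval fun i => AddMonoidAlgebra.single (v i) (c i)

theorem eval_monomialSubst (c : ι → k) (v : ι → L) (f : MvPolynomial ι k) (t : Torus k L) :
    Torus.eval (monomialSubst c v f) t =
      MvPolynomial.eval (fun i => c i * Torus.monomial (v i) t) f := by
  rw [← Torus.evalHom_apply]
  have : (Torus.evalHom t).comp (monomialSubst c v) =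
      MvPolynomial.aeval (fun i => c i * Torus.monomial (v i) t) :=
    MvPolynomial.algHom_ext fun i => by
      simp [monomialSubst, Torus.evalHom_apply, Torus.eval_single]
  simpa using DFunLike.congr_fun this f

/-- The binomial `x^a - x^b`. -/
def binomial [Fintype ι] (k : Type*) [Field k] (a b : ι → ℕ) : MvPolynomial ι k :=
  MvPolynomial.monomial (Finsupp.equivFunOnFinite.symm a) 1 -
    MvPolynomial.monomial (Finsupp.equivFunOnFinite.symm b) 1

theorem eval_binomial [Fintype ι] (a b : ι → ℕ) (x : ι → k) :
    MvPolynomial.eval x (binomial k a b) = ∏ i, x i ^ a i - ∏ i, x i ^ b i := by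
  rw [binomial, map_sub, MvPolynomial.eval_monomial, MvPolynomial.eval_monomial,
    Finsupp.prod_fintype _ _ (fun i => pow_zero _), Finsupp.prod_fintype _ _ (fun i => pow_zero _)]
  simp

theorem binomial_isHomogeneous [Fintype ι] {a b : ι → ℕ} (hab : ∑ i, a i = ∑ i, b i) :
    (binomial k a b).IsHomogeneous (∑ i, a i) := by
  refine MvPolynomial.IsHomogeneous.sub ?_ ?_
  · exact MvPolynomial.isHomogeneous_monomial _ (by simp [Finsupp.degree_eq_sum])
  · exact MvPolynomial.isHomogeneous_monomial _ (by simp [Finsupp.degree_eq_sum, hab])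

theorem isOpen_forall_rep_ne_zero [Fintype ι] : IsOpen {x : ℙ k (ι → k) | ∀ i, x.rep i ≠ 0} := by
  have : {x : ℙ k (ι → k) | ∀ i, x.rep i ≠ 0} = ⋂ i, {x | x.rep i ≠ 0} := by
    ext; simp
  rw [this]
  exact isOpen_iInter_of_finite isOpen_rep_ne_zero

variable [Nonempty ι]

theorem exists_rep_torusMap (v : ι → L) (t : Torus k L) :
    ∃ a : k, a ≠ 0 ∧ ∀ i, (torusMap k v t).rep i = a * Torus.monomial (v i) t := by
  obtain ⟨a, ha⟩ := Projectivization.exists_smul_eq_mk_rep k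
    (fun i => Torus.monomial (v i) t)
    (fun h => (t (Multiplicative.ofAdd (v (Classical.arbitrary ι)))).ne_zero (congrFun h _))
  exact ⟨a, a.ne_zero, fun i => (congrFun ha i).symm⟩

theorem rep_torusMap_ne_zero (v : ι → L) (t : Torus k L) (i : ι) :
    (torusMap k v t).rep i ≠ 0 := by
  obtain ⟨a, ha, h⟩ := exists_rep_torusMap v t
  rw [h]
  exact mul_ne_zero ha (Torus.monomial_ne_zero _ _)

theorem eval_rep_torusMap_eq_zero (v : ι → L) (t : Torus k L) {f : MvPolynomial ι k} {d : ℕ}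
    (hf : f.IsHomogeneous d) : MvPolynomial.eval (torusMap k v t).rep f = 0 ↔
      MvPolynomial.eval (fun i => Torus.monomial (v i) t) f = 0 :=
  eval_rep_mk_eq_zero hf _

theorem continuous_torusMap (v : ι → L) : Continuous (torusMap k v) := by
  refine isTopologicalBasis_zariskiProj.continuous_iff.2 ?_
  rintro _ ⟨d, f, hf, rfl⟩
  have h := Torus.isOpen_eval_ne_zero (monomialSubst (fun _ => 1) v f)
  convert h using 1
  ext t
  simp only [Set.mem_preimage, Set.mem_ofPred_eq, ne_eq, eval_rep_torusMap_eq_zero v t hf,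
    eval_monomialSubst, one_mul]

/-- A point of projective space fixes the `z^{v_i}(t)` up to a common scalar, and this scalar
cancels in integer combinations of total weight zero. By hypothesis these combinations reach all of
the lattice. -/
theorem torusMap_injective {v : ι → L}
    (hv : ∀ m, ∃ a : ι →₀ ℤ, (a.sum fun _ x => x) = 0 ∧ (a.sum fun i x => x • v i) = m) :
    Function.Injective (torusMap k v) := by
  intro s t hst
  obtain ⟨c, hc, hs⟩ := exists_rep_torusMap v s
  obtain ⟨d, hd, ht⟩ := exists_rep_torusMap v t
  have hr : ∀ i, Torus.monomial (v i) s = d / c * Torus.monomial (v i) t := fun i => by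
    have := hs i
    rw [hst, ht] at this
    field_simp
    linear_combination -this
  refine Torus.ext_monomial fun m => ?_
  obtain ⟨a, ha, rfl⟩ := hv m
  simp only [Finsupp.sum, Torus.monomial_sum, Torus.monomial_zsmul, hr, mul_zpow,
    Finset.prod_mul_distrib]
  have h0 : ∏ i ∈ a.support, (d / c) ^ a i = (d / c) ^ (∑ i ∈ a.support, a i) := by
    classical
    have hdc : d / c ≠ 0 := div_ne_zero hd hc
    induction a.support using Finset.induction_on with
    | empty => simp
    | insert i s hi ih => rw [Finset.prod_insert hi, Finset.sum_insert hi, zpow_add₀ hdc, ih]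
  rw [h0, show ∑ i ∈ a.support, a i = 0 from ha]
  simp

variable [Fintype ι]

/-- It must be shown that each principal open set of the torus comes from projective space. Writing
exponents as weight-zero combinations of the `v_i` and multiplying by a high power of `∏ x_i` turns
a Laurent polynomial into a homogeneous polynomial with the same zeros on the torus. -/
theorem isEmbedding_torusMap {v : ι → L}
    (hv : ∀ m, ∃ a : ι → ℤ, ∑ i, a i = 0 ∧ ∑ i, a i • v i = m) :
    Topology.IsEmbedding (torusMap k v) := by
  refine ⟨⟨le_antisymm (continuous_torusMap v).le_induced (le_generateFrom ?_)⟩, ?_⟩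
  · rintro _ ⟨f, rfl⟩
    choose a ha0 ha using hv
    -- Large enough that adding `e` to every exponent makes all of them nonnegative, simultaneously
    -- for all terms of `f`.
    let e : ℕ := ∑ m ∈ f.coeff.support, ∑ i, (a m i).natAbs
    have he : ∀ m ∈ f.coeff.support, ∀ i, 0 ≤ a m i + e := by
      intro m hm i
      have h1 : (a m i).natAbs ≤ ∑ i, (a m i).natAbs :=
        Finset.single_le_sum (f := fun i => (a m i).natAbs) (fun _ _ => Nat.zero_le _)
          (Finset.mem_univ i)
      have h2 : ∑ i, (a m i).natAbs ≤ e :=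
        Finset.single_le_sum (f := fun m => ∑ i, (a m i).natAbs) (fun _ _ => Nat.zero_le _) hm
      omega
    let F : MvPolynomial ι k := ∑ m ∈ f.coeff.support,
      MvPolynomial.monomial (Finsupp.equivFunOnFinite.symm fun i => (a m i + e).toNat) (f.coeff m)
    have hF : F.IsHomogeneous (Fintype.card ι * e) := by
      refine MvPolynomial.IsHomogeneous.sum _ _ _ fun m hm => ?_
      refine MvPolynomial.isHomogeneous_monomial _ ?_
      rw [Finsupp.degree_eq_sum]
      zify
      simp only [Finsupp.coe_equivFunOnFinite_symm]
      rw [Finset.sum_congr rfl fun i _ => Int.toNat_of_nonneg (he m hm i)]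
      simp [Finset.sum_add_distrib, ha0]
    refine ⟨_, isOpen_eval_ne_zero hF, ?_⟩
    ext t
    have h3 : MvPolynomial.eval (fun i => Torus.monomial (v i) t) F =
        Torus.monomial (∑ i, e • v i) t * Torus.eval f t := by
      simp only [F, map_sum, MvPolynomial.eval_monomial, Torus.eval, Finsupp.sum, Finset.mul_sum]
      refine Finset.sum_congr rfl fun m hm => ?_
      rw [Finsupp.prod_fintype _ _ (fun i => pow_zero _)]
      have h4 : m + ∑ i, e • v i = ∑ i, (a m i + e).toNat • v i := by
        conv_lhs => rw [← ha m]
        rw [← Finset.sum_add_distrib]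
        refine Finset.sum_congr rfl fun i _ => ?_
        rw [← natCast_zsmul, ← natCast_zsmul, Int.toNat_of_nonneg (he m hm i), add_zsmul]
      have h5 := congrArg (fun x => Torus.monomial x t) h4
      simp only [Torus.monomial_add, Torus.monomial_sum _ (fun i => (a m i + e).toNat • v i),
        Torus.monomial_nsmul] at h5
      simp only [Finsupp.coe_equivFunOnFinite_symm]
      rw [← h5]
      ring
    simp only [Set.mem_preimage, Set.mem_ofPred_eq, ne_eq, eval_rep_torusMap_eq_zero v t hF, h3,
      mul_eq_zero, Torus.monomial_ne_zero, false_or]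
  · refine torusMap_injective fun m => ?_
    obtain ⟨a, ha0, ha⟩ := hv m
    refine ⟨Finsupp.equivFunOnFinite.symm a, ?_, ?_⟩
    · rw [Finsupp.sum_fintype _ _ (fun _ => rfl)]
      simpa using ha0
    · rw [Finsupp.sum_fintype _ _ (fun _ => zero_zsmul _)]
      simpa using ha

theorem eval_binomial_eq_zero {v : ι → L} {a b : ι → ℕ} (hab : ∑ i, a i = ∑ i, b i)
    (hv : ∑ i, a i • v i = ∑ i, b i • v i) {y : ℙ k (ι → k)} (hy : y ∈ toricVariety k v) :
    MvPolynomial.eval y.rep (binomial k a b) = 0 := by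
  refine mem_closure_iff_eval.1 hy _ _ (binomial_isHomogeneous hab) ?_
  rintro _ ⟨t, rfl⟩
  rw [eval_rep_torusMap_eq_zero v t (binomial_isHomogeneous hab), eval_binomial, sub_eq_zero]
  simpa only [Torus.monomial_sum, Torus.monomial_nsmul] using
    congrArg (fun x => Torus.monomial x t) hv

/-- On its support, each point of a toric variety agrees with a point of the torus. -/
theorem exists_torus_eq_of_mem_toricVariety [IsAlgClosed k] {v : ι → L} {y : ℙ k (ι → k)}
    (hy : y ∈ toricVariety k v) : ∃ (c : k) (t : Torus k L), c ≠ 0 ∧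
      ∀ i, y.rep i ≠ 0 → y.rep i = c * Torus.monomial (v i) t := by
  classical
  let S := {i : ι // y.rep i ≠ 0}
  let s : Torus k (S → ℤ) := Torus.ofBasis (Pi.basisFun ℤ S) fun i => Units.mk0 (y.rep i) i.2
  have hs : ∀ m : S → ℤ, Torus.monomial m s = ∏ i : S, y.rep i ^ m i := fun m => by
    simp [s, Torus.monomial_ofBasis]
  -- The second factor ℤ records the degree; its character will supply the scalar `c`. An element of
  -- the kernel is a homogeneous integer relation among the `v_i` with `i` in the support of `y`.
  let f : (S → ℤ) →+ L × ℤ :=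
    { toFun := fun m => (∑ i, m i • v i, ∑ i, m i)
      map_zero' := by simp
      map_add' := fun m m' => by simp [add_zsmul, Finset.sum_add_distrib] }
  obtain ⟨t, ht⟩ := exists_torus_comp_eq f s (by
    intro m hm
    have hm1 : ∑ i : S, m i • v i = 0 := congrArg Prod.fst hm
    have hm2 : ∑ i : S, m i = 0 := congrArg Prod.snd hm
    -- The positive and negative parts of the relation, extended by zero off the support: `x^a -
    -- x^b` is a homogeneous binomial that vanishes on the toric variety.
    let a : ι → ℕ := fun i => if h : y.rep i ≠ 0 then (m ⟨i, h⟩).toNat else 0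
    let b : ι → ℕ := fun i => if h : y.rep i ≠ 0 then (-m ⟨i, h⟩).toNat else 0
    have ha : ∀ i : S, a i = (m i).toNat := fun i => dif_pos i.2
    have hb : ∀ i : S, b i = (-m i).toNat := fun i => dif_pos i.2
    have ha' : ∀ i ∉ Set.range (Subtype.val : S → ι), a i = 0 := fun i hi =>
      dif_neg fun h => hi ⟨⟨i, h⟩, rfl⟩
    have hb' : ∀ i ∉ Set.range (Subtype.val : S → ι), b i = 0 := fun i hi =>
      dif_neg fun h => hi ⟨⟨i, h⟩, rfl⟩
    have hab : ∑ i, a i = ∑ i, b i := by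
      rw [← Fintype.sum_of_injective _ Subtype.val_injective (fun i : S => a i) a ha'
          (fun _ => rfl),
        ← Fintype.sum_of_injective _ Subtype.val_injective (fun i : S => b i) b hb'
          (fun _ => rfl)]
      zify
      rw [← sub_eq_zero, ← Finset.sum_sub_distrib, ← hm2]
      refine Finset.sum_congr rfl fun i _ => ?_
      rw [ha, hb]
      omega
    have hvab : ∑ i, a i • v i = ∑ i, b i • v i := by
      rw [← Fintype.sum_of_injective _ Subtype.val_injective (fun i : S => a i • v i)
          (fun i => a i • v i) (fun i hi => by rw [ha' i hi, zero_smul]) (fun _ => rfl),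
        ← Fintype.sum_of_injective _ Subtype.val_injective (fun i : S => b i • v i)
          (fun i => b i • v i) (fun i hi => by rw [hb' i hi, zero_smul]) (fun _ => rfl)]
      rw [← sub_eq_zero, ← Finset.sum_sub_distrib, ← hm1]
      refine Finset.sum_congr rfl fun i _ => ?_
      rw [ha, hb, ← natCast_zsmul, ← natCast_zsmul, ← sub_smul]
      congr 1
      omega
    have h0 := eval_binomial_eq_zero hab hvab hy
    rw [eval_binomial, sub_eq_zero,
      ← Fintype.prod_of_injective _ Subtype.val_injective (fun i : S => y.rep i ^ a i)
        (fun i => y.rep i ^ a i) (fun i hi => by rw [ha' i hi, pow_zero]) (fun _ => rfl),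
      ← Fintype.prod_of_injective _ Subtype.val_injective (fun i : S => y.rep i ^ b i)
        (fun i => y.rep i ^ b i) (fun i hi => by rw [hb' i hi, pow_zero]) (fun _ => rfl)] at h0
    have hne : ∏ i : S, y.rep i ^ b i ≠ 0 :=
      Finset.prod_ne_zero_iff.2 fun i _ => pow_ne_zero _ i.2
    rw [hs, ← div_self hne]
    nth_rewrite 1 [← h0]
    rw [← Finset.prod_div_distrib]
    refine Finset.prod_congr rfl fun i _ => ?_
    rw [← zpow_natCast, ← zpow_natCast, ← zpow_sub₀ i.2, ha, hb]
    congr 1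
    omega)
  refine ⟨Torus.monomial (0, 1) t, Torus.induced k (AddMonoidHom.inl L ℤ) t,
    Torus.monomial_ne_zero _ _, fun i hi => ?_⟩
  have h1 := congrArg (fun r => Torus.monomial (Pi.single ⟨i, hi⟩ 1) r) ht
  simp only [Torus.monomial_induced, hs] at h1
  have h2 : f (Pi.single ⟨i, hi⟩ 1) = (0, 1) + (v i, 0) := by
    refine Prod.ext ?_ ?_
    · refine (Fintype.sum_eq_single (⟨i, hi⟩ : S) ?_).trans ?_ <;> simp +contextual
    · refine (Fintype.sum_eq_single (⟨i, hi⟩ : S) ?_).trans ?_ <;> simp +contextual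
  rw [h2, Torus.monomial_add, Finset.prod_eq_single ⟨i, hi⟩] at h1
  · rw [Torus.monomial_induced]
    simpa using h1.symm
  all_goals simp +contextual

theorem range_torusMap [IsAlgClosed k] (v : ι → L) :
    Set.range (torusMap k v) = toricVariety k v ∩ {x | ∀ i, x.rep i ≠ 0} := by
  ext y
  constructor
  · rintro ⟨t, rfl⟩
    exact ⟨subset_closure ⟨t, rfl⟩, rep_torusMap_ne_zero v t⟩
  · rintro ⟨hy, hne⟩
    obtain ⟨c, t, hc, h⟩ := exists_torus_eq_of_mem_toricVariety hy
    refine ⟨t, ?_⟩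
    rw [← y.mk_rep, torusMap, Projectivization.mk_eq_mk_iff']
    exact ⟨c⁻¹, funext fun i => by simp [h i (hne i), hc]⟩

theorem isDenseOpenIn_torusMap [IsAlgClosed k] {v : ι → L}
    (hv : ∀ m, ∃ a : ι → ℤ, ∑ i, a i = 0 ∧ ∑ i, a i • v i = m) :
    IsDenseOpenIn (torusMap k v) (toricVariety k v) :=
  ⟨isEmbedding_torusMap hv, ⟨_, isOpen_forall_rep_ne_zero, range_torusMap v⟩, subset_rfl⟩

end Toric

/-! ### Dimension -/

section Dimension

variable {k : Type*} [Field k] {L ι : Type*} [AddCommGroup L]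

/-- The Laurent ring is algebraic over the subring generated by the monomials of a basis, because
each Laurent monomial is a quotient of two monomials with nonnegative exponents. -/
theorem trdeg_addMonoidAlgebra_le [Module.Free ℤ L] [Module.Finite ℤ L] :
    Algebra.trdeg k (AddMonoidAlgebra k L) ≤ Module.finrank ℤ L := by
  classical
  have hdom := Torus.isDomain_addMonoidAlgebra (k := k) (M := L)
  let b := Module.finBasis ℤ L
  let x : Fin (Module.finrank ℤ L) → AddMonoidAlgebra k L := fun i => AddMonoidAlgebra.single (b i) 1
  let R := Algebra.adjoin k (Set.range x)
  have hx : ∀ i, x i ∈ R := fun i => Algebra.subset_adjoin ⟨i, rfl⟩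
  have hmon : ∀ e : Fin (Module.finrank ℤ L) → ℕ,
      AddMonoidAlgebra.single (∑ i, e i • b i) (1 : k) = ∏ i, x i ^ e i := fun e => by
    simp only [x, AddMonoidAlgebra.single_pow, one_pow, AddMonoidAlgebra.prod_single,
      Finset.prod_const_one]
  have hmem : ∀ e : Fin (Module.finrank ℤ L) → ℕ, ∏ i, x i ^ e i ∈ R := fun e =>
    prod_mem fun i _ => pow_mem (hx i) _
  have halg : Algebra.IsAlgebraic R (AddMonoidAlgebra k L) := by
    refine ⟨fun f => ?_⟩
    induction f using AddMonoidAlgebra.induction_linear with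
    | zero => exact isAlgebraic_zero
    | add f g hf hg => exact hf.add hg
    | single m c =>
      let p : Fin (Module.finrank ℤ L) → ℕ := fun i => (b.repr m i).toNat
      let q : Fin (Module.finrank ℤ L) → ℕ := fun i => (-b.repr m i).toNat
      let r : R := ⟨∏ i, x i ^ q i, hmem q⟩
      let r' : R := ⟨c • ∏ i, x i ^ p i, R.smul_mem (hmem p) c⟩
      have hr : r ≠ 0 := fun h0 => by
        have h1 : AddMonoidAlgebra.single (∑ i, q i • b i) (1 : k) = 0 := by
          rw [hmon]; exact congrArg Subtype.val h0
        exact one_ne_zero (AddMonoidAlgebra.single_eq_zero.1 h1)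
      have hm : ∑ i, q i • b i + m = ∑ i, p i • b i := by
        conv_lhs => rw [← b.sum_repr m]
        rw [← Finset.sum_add_distrib]
        refine Finset.sum_congr rfl fun i _ => ?_
        rw [← natCast_zsmul, ← natCast_zsmul, ← add_smul]
        congr 1
        simp only [p, q]
        omega
      -- The linear equation `r X = r'`, where `r` and `r'` carry the negative and the positive
      -- exponents of `m`.
      refine ⟨Polynomial.C r * Polynomial.X - Polynomial.C r', fun h0 => hr ?_, ?_⟩
      · simpa using congrArg (fun P => Polynomial.coeff P 1) h0
      · have h2 : (r : AddMonoidAlgebra k L) * AddMonoidAlgebra.single m c = r' := by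
          simp only [r, r', ← hmon, AddMonoidAlgebra.single_mul_single, hm,
            AddMonoidAlgebra.smul_single, one_mul, smul_eq_mul, mul_one]
        simp only [map_sub, map_mul, Polynomial.aeval_C, Polynomial.aeval_X, sub_eq_zero]
        exact h2
  refine (Algebra.IsAlgebraic.trdeg_le_cardinalMk k (Set.range x)).trans ?_
  simpa only [Cardinal.mk_fin, Cardinal.lift_natCast, Cardinal.lift_uzero] using
    Cardinal.mk_range_le_lift (f := x)

/-- By Noether normalization `A` is integral over a polynomial ring in `s` variables. These remain
algebraically independent in the Laurent ring, which bounds `s`, and contraction of primes along an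
integral extension is strictly monotone, which bounds the dimension by `s`. -/
theorem ringKrullDim_le_of_injective {A : Type*} [CommRing A] [Nontrivial A] [Algebra k A]
    [Algebra.FiniteType k A] [Module.Free ℤ L] [Module.Finite ℤ L]
    (f : A →ₐ[k] AddMonoidAlgebra k L) (hf : Function.Injective f) :
    ringKrullDim A ≤ Module.finrank ℤ L := by
  obtain ⟨s, g, hg, hgi⟩ := exists_integral_inj_algHom_of_fg k A
  have hs : s ≤ Module.finrank ℤ L := by
    have hind : AlgebraicIndependent k fun i => f (g (MvPolynomial.X i)) := by
      rw [AlgebraicIndependent]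
      have : MvPolynomial.aeval (fun i => f (g (MvPolynomial.X i))) = f.comp g :=
        MvPolynomial.algHom_ext fun i => by simp
      rw [this]
      exact hf.comp hg
    have h1 := hind.lift_cardinalMk_le_trdeg.trans
      (Cardinal.lift_le.2 trdeg_addMonoidAlgebra_le)
    simpa using h1
  have h2 : ringKrullDim A ≤ ringKrullDim (MvPolynomial (Fin s) k) := by
    refine Order.krullDim_le_of_strictMono (PrimeSpectrum.comap g.toRingHom) fun p q hpq => ?_
    algebraize [g.toRingHom]
    exact Ideal.IsIntegral.comap_lt_comap (R := MvPolynomial (Fin s) k) (A := A)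
      (I := p.asIdeal) (J := q.asIdeal) hpq
  refine h2.trans ?_
  rw [MvPolynomial.ringKrullDim_of_isNoetherianRing, ringKrullDim_eq_zero_of_field]
  simpa using hs

/-! ### Affine charts of projective space -/

section Chart

/-- The homogenization of a polynomial with respect to the variable `x_j`. -/
def chartHomogenize (j : ι) (f : MvPolynomial ι k) : MvPolynomial ι k :=
  ∑ d ∈ Finset.range (f.totalDegree + 1),
    MvPolynomial.X j ^ (f.totalDegree - d) * MvPolynomial.homogeneousComponent d f

theorem chartHomogenize_isHomogeneous (j : ι) (f : MvPolynomial ι k) :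
    (chartHomogenize j f).IsHomogeneous f.totalDegree := by
  refine MvPolynomial.IsHomogeneous.sum _ _ _ fun d hd => ?_
  have h := (MvPolynomial.isHomogeneous_X_pow (R := k) j (f.totalDegree - d)).mul
    (MvPolynomial.homogeneousComponent_isHomogeneous d f)
  rwa [Nat.sub_add_cancel (Nat.lt_succ_iff.1 (Finset.mem_range.1 hd))] at h

theorem eval_chartHomogenize (j : ι) (f : MvPolynomial ι k) {y : ι → k} (hy : y j ≠ 0) :
    MvPolynomial.eval y (chartHomogenize j f) =
      y j ^ f.totalDegree * MvPolynomial.eval ((y j)⁻¹ • y) f := by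
  have hs := congrArg (MvPolynomial.eval ((y j)⁻¹ • y)) (MvPolynomial.sum_homogeneousComponent f)
  rw [map_sum] at hs
  rw [← hs, chartHomogenize, map_sum, Finset.mul_sum]
  refine Finset.sum_congr rfl fun d hd => ?_
  rw [eval_smul_of_isHomogeneous (MvPolynomial.homogeneousComponent_isHomogeneous d f),
    ← mul_assoc, map_mul, map_pow, MvPolynomial.eval_X]
  congr 1
  rw [inv_pow, ← div_eq_mul_inv, eq_div_iff (pow_ne_zero _ hy), ← pow_add,
    Nat.sub_add_cancel (Nat.lt_succ_iff.1 (Finset.mem_range.1 hd))]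

/-- The polynomials in the affine coordinates of the chart `x_j ≠ 0` that vanish on `Z`. -/
def chartIdeal (j : ι) (Z : Set (ℙ k (ι → k))) : Ideal (MvPolynomial ι k) where
  carrier := {f | ∀ y ∈ Z, y.rep j ≠ 0 → MvPolynomial.eval ((y.rep j)⁻¹ • y.rep) f = 0}
  add_mem' {f g} hf hg y hy hj := by rw [map_add, hf y hy hj, hg y hy hj, add_zero]
  zero_mem' y hy hj := map_zero _
  smul_mem' c f hf y hy hj := by rw [smul_eq_mul, map_mul, hf y hy hj, mul_zero]

theorem mem_chartIdeal {j : ι} {Z : Set (ℙ k (ι → k))} {f : MvPolynomial ι k} :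
    f ∈ chartIdeal j Z ↔
      ∀ y ∈ Z, y.rep j ≠ 0 → MvPolynomial.eval ((y.rep j)⁻¹ • y.rep) f = 0 := Iff.rfl

theorem isOpen_chart_eval_ne_zero (j : ι) (f : MvPolynomial ι k) :
    IsOpen {y : ℙ k (ι → k) | y.rep j ≠ 0 ∧ MvPolynomial.eval ((y.rep j)⁻¹ • y.rep) f ≠ 0} := by
  have h := isOpen_eval_ne_zero
    ((MvPolynomial.isHomogeneous_X k j).mul (chartHomogenize_isHomogeneous j f))
  convert h using 1
  ext y
  simp only [Set.mem_ofPred_eq, map_mul, MvPolynomial.eval_X, mul_ne_zero_iff]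
  refine and_congr_right fun hj => ?_
  rw [eval_chartHomogenize j f hj, mul_ne_zero_iff, and_iff_right (pow_ne_zero _ hj)]

theorem chartIdeal_isPrime {j : ι} {Z : Set (ℙ k (ι → k))} (hZ : IsIrreducible Z)
    (hj : ∃ y ∈ Z, y.rep j ≠ 0) : (chartIdeal j Z).IsPrime := by
  refine Ideal.isPrime_iff.2 ⟨fun h => ?_, fun {f g} hfg => ?_⟩
  · obtain ⟨y, hy, hyj⟩ := hj
    have h1 : (1 : MvPolynomial ι k) ∈ chartIdeal j Z := h ▸ Submodule.mem_top
    simpa using h1 y hy hyj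
  · by_contra hne
    simp only [mem_chartIdeal, not_or, not_forall] at hne
    obtain ⟨⟨y, hy, hyj, hyf⟩, ⟨z, hz, hzj, hzg⟩⟩ := hne
    obtain ⟨w, hw, hwf, hwg⟩ := hZ.2 _ _ (isOpen_chart_eval_ne_zero j f)
      (isOpen_chart_eval_ne_zero j g) ⟨y, hy, hyj, hyf⟩ ⟨z, hz, hzj, hzg⟩
    have := hfg w hw hwf.1
    rw [map_mul] at this
    exact mul_ne_zero hwf.2 hwg.2 this

/-- Some homogeneous equation of `Z` does not vanish on all of `Z'`. As `Z'` is irreducible and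
meets the chart, the equation is nonzero at a point of `Z'` inside the chart, so it still separates
the two ideals. -/
theorem chartIdeal_lt {j : ι} {Z Z' : Set (ℙ k (ι → k))} (hZ : IsClosed Z)
    (hZ' : IsIrreducible Z') (hlt : Z ⊂ Z') (hj : ∃ y ∈ Z', y.rep j ≠ 0) :
    chartIdeal j Z' < chartIdeal j Z := by
  refine lt_of_le_of_ne (fun f hf y hy => hf y (hlt.1 hy)) fun heq => ?_
  obtain ⟨y, hy', hy⟩ := Set.exists_of_ssubset hlt
  rw [← hZ.closure_eq, mem_closure_iff_eval] at hy
  push Not at hy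
  obtain ⟨d, f, hf, hfZ, hfy⟩ := hy
  obtain ⟨z, hz, hzj⟩ := hj
  obtain ⟨w, hw, hwf, hwj⟩ := hZ'.2 _ _ (isOpen_eval_ne_zero hf) (isOpen_rep_ne_zero j)
    ⟨y, hy', hfy⟩ ⟨z, hz, hzj⟩
  have hmem : f ∈ chartIdeal j Z := fun x hx hxj => by
    rw [eval_smul_of_isHomogeneous hf, hfZ x hx, mul_zero]
  rw [← heq] at hmem
  have h1 := hmem w hw hwj
  rw [eval_smul_of_isHomogeneous hf] at h1
  exact mul_ne_zero (pow_ne_zero _ (inv_ne_zero hwj)) hwf h1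

end Chart

/-- The points `[c_i z^{v_i}(t)]` of projective space, for `t` in the torus. -/
def monomialImage (c : ι → k) (v : ι → L) : Set (ℙ k (ι → k)) :=
  {y | ∃ (t : Torus k L) (a : k), ∀ i, y.rep i = a * (c i * Torus.monomial (v i) t)}

theorem ker_monomialSubst_le_chartIdeal {c : ι → k} {v : ι → L} {j : ι} (hc : c j ≠ 0)
    {Z : Set (ℙ k (ι → k))} (hZ : Z ⊆ closure (monomialImage c v)) :
    RingHom.ker (monomialSubst (fun i => c i / c j) fun i => v i - v j) ≤ chartIdeal j Z := by
  intro g hg y hy hj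
  have h := mem_closure_iff_eval.1 (hZ hy) _ _ (chartHomogenize_isHomogeneous j g) (by
    rintro x ⟨t, a, hx⟩
    by_cases hxj : x.rep j = 0
    · exfalso
      have ha : a = 0 := by
        by_contra ha
        rw [hx j] at hxj
        exact mul_ne_zero ha (mul_ne_zero hc (Torus.monomial_ne_zero _ _)) hxj
      exact x.rep_nonzero (funext fun i => by simp [hx i, ha])
    · rw [eval_chartHomogenize j g hxj]
      have h1 : (x.rep j)⁻¹ • x.rep =
          fun i => c i / c j * Torus.monomial (v i - v j) t := by
        have ha : a ≠ 0 := by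
          rintro rfl
          exact hxj (by simp [hx])
        have ht := Torus.monomial_ne_zero (v j) t
        funext i
        rw [Pi.smul_apply, smul_eq_mul, hx, hx, Torus.monomial_sub]
        field_simp
      rw [h1, ← eval_monomialSubst, (RingHom.mem_ker).1 hg]
      simp [Torus.eval])
  rw [eval_chartHomogenize j g hj] at h
  exact (mul_eq_zero.1 h).resolve_left (pow_ne_zero _ hj)

/-- A chart around a point of the smallest member sees the whole chain, as a chain of primes
containing the kernel of the monomial substitution. The quotient by this kernel embeds in the
Laurent ring of `L`. -/
theorem length_le_of_last_subset [Finite ι] [Module.Free ℤ L] [Module.Finite ℤ L]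
    {c : ι → k} {v : ι → L}
    (p : LTSeries (TopologicalSpace.IrreducibleCloseds (ℙ k (ι → k))))
    (hp : (p.last : Set (ℙ k (ι → k))) ⊆ closure (monomialImage c v)) :
    p.length ≤ Module.finrank ℤ L := by
  have hdom := Torus.isDomain_addMonoidAlgebra (k := k) (M := L)
  obtain ⟨y, hy⟩ := p.head.isIrreducible.nonempty
  obtain ⟨j, hj⟩ : ∃ j, y.rep j ≠ 0 := Function.ne_iff.1 y.rep_nonzero
  have hmem : ∀ i, y ∈ p i := fun i => p.head_le i hy
  have hsub : ∀ i, (p i : Set (ℙ k (ι → k))) ⊆ closure (monomialImage c v) := fun i =>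
    (show (p i : Set (ℙ k (ι → k))) ⊆ p.last from p.monotone (Fin.le_last i)).trans hp
  have hc : c j ≠ 0 := fun hc => hj (by
    have h1 := mem_closure_iff_eval.1 (hp (hmem _)) 1 (MvPolynomial.X j)
      (MvPolynomial.isHomogeneous_X k j) (by rintro x ⟨t, a, hx⟩; simp [hx, hc])
    simpa using h1)
  let Φ := monomialSubst (fun i => c i / c j) fun i => v i - v j
  -- The order is reversed, since larger closed sets have smaller ideals.
  let q : Fin (p.length + 1) → (PrimeSpectrum.zeroLocus (RingHom.ker Φ : Set (MvPolynomial ι k)))ᵒᵈ :=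
    fun i => OrderDual.toDual ⟨⟨chartIdeal j (p i),
      chartIdeal_isPrime (p i).isIrreducible ⟨y, hmem i, hj⟩⟩,
      ker_monomialSubst_le_chartIdeal hc (hsub i)⟩
  have hq : StrictMono q := fun i i' hii' =>
    chartIdeal_lt (p i).isClosed (p i').isIrreducible (p.strictMono hii') ⟨y, hmem i', hj⟩
  have h1 := Order.LTSeries.length_le_krullDim (LTSeries.mk _ q hq)
  rw [Order.krullDim_orderDual, ← ringKrullDim_quotient] at h1
  have := (RingHom.ker_isPrime Φ.toRingHom).ne_top
  have : Nontrivial (MvPolynomial ι k ⧸ RingHom.ker Φ) := Ideal.Quotient.nontrivial_iff.2 this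
  have h2 := ringKrullDim_le_of_injective (k := k) (A := MvPolynomial ι k ⧸ RingHom.ker Φ)
    (Ideal.kerLiftAlg Φ) (Ideal.kerLiftAlg_injective Φ)
  exact_mod_cast h1.trans h2

/-- The dimension of a space that lies in the union of finitely many images of tori. -/
theorem topologicalKrullDim_le_of_isInducing [Finite ι] [Module.Free ℤ L] [Module.Finite ℤ L]
    {T : Type*} [TopologicalSpace T] {f : T → ℙ k (ι → k)} (hf : Topology.IsInducing f)
    {σ : Type*} [Finite σ] (c : σ → ι → k) (v : ι → L)
    (hT : ∀ x, ∃ s, f x ∈ closure (monomialImage (c s) v)) :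
    topologicalKrullDim T ≤ Module.finrank ℤ L := by
  classical
  refine iSup_le fun p => ?_
  let F := TopologicalSpace.IrreducibleCloseds.map f hf.continuous
  have hF : StrictMono F :=
    TopologicalSpace.IrreducibleCloseds.map_strictMono_of_isInducing hf
  -- Only finitely many closed sets cover the image, so the irreducible top of the chain lies in a
  -- single one of them.
  obtain ⟨z, hz, hsub⟩ := isIrreducible_iff_sUnion_isClosed.1 (F p.last).isIrreducible
    (Set.finite_range fun s => closure (monomialImage (c s) v)).toFinset
    (by
      intro z hz
      obtain ⟨s, rfl⟩ := (Set.Finite.mem_toFinset _).1 hz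
      exact isClosed_closure)
    (by
      rw [Set.Finite.coe_toFinset, Set.sUnion_range]
      refine closure_minimal ?_ (isClosed_iUnion_of_finite fun s => isClosed_closure)
      rintro _ ⟨x, -, rfl⟩
      exact Set.mem_iUnion.2 (hT x))
  obtain ⟨s, rfl⟩ := (Set.Finite.mem_toFinset _).1 hz
  have := length_le_of_last_subset (p.map F hF) (by rwa [LTSeries.last_map])
  exact_mod_cast this

/-- The chain is the flag of coordinate subtori. The `j`-th one, where all coordinates with index at
least `j` equal 1, is the image of the torus under the endomorphism dual to the projection `P j`:
irreducible as an image, closed as the fixed locus of an idempotent. -/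
theorem finrank_le_topologicalKrullDim_torus [Infinite k] [Module.Free ℤ L] [Module.Finite ℤ L] :
    (Module.finrank ℤ L : WithBot ℕ∞) ≤ topologicalKrullDim (Torus k L) := by
  let b := Module.finBasis ℤ L
  let P : ℕ → L →+ L := fun j =>
    (b.constr ℤ fun i => if (i : ℕ) < j then b i else 0).toAddMonoidHom
  have hP : ∀ j i, P j (b i) = if (i : ℕ) < j then b i else 0 := fun j i => b.constr_basis ℤ _ _
  have hPP : ∀ i j m, i ≤ j → P i (P j m) = P i m := by
    intro i j m hij
    have : (b.constr ℤ fun l => if (l : ℕ) < i then b l else 0) ∘ₗ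
        (b.constr ℤ fun l => if (l : ℕ) < j then b l else 0) =
        b.constr ℤ fun l => if (l : ℕ) < i then b l else 0 := by
      refine b.ext fun l => ?_
      rw [LinearMap.comp_apply, b.constr_basis, b.constr_basis]
      split_ifs with h1 h2 h2
      · rw [b.constr_basis, if_pos h2]
      · rw [b.constr_basis, if_neg h2]
      · omega
      · rw [map_zero]
    exact LinearMap.congr_fun this m
  have hfix : ∀ j, Set.range (Torus.induced k (P j)) =
      ⋂ m, {t | Torus.monomial (P j m) t = Torus.monomial m t} := by
    intro j
    ext t
    simp only [Set.mem_iInter, Set.mem_ofPred_eq]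
    constructor
    · rintro ⟨s, rfl⟩ m
      rw [Torus.monomial_induced, Torus.monomial_induced, hPP j j m le_rfl]
    · intro h
      exact ⟨t, Torus.ext_monomial fun m => h m⟩
  let Z : ℕ → TopologicalSpace.IrreducibleCloseds (Torus k L) := fun j =>
    { carrier := Set.range (Torus.induced k (P j))
      isIrreducible' := by
        rw [← Set.image_univ]
        exact Torus.isIrreducible_univ.image _ (Torus.continuous_induced _).continuousOn
      isClosed' := by
        rw [hfix]
        exact isClosed_iInter fun m => Torus.isClosed_monomial_eq _ _ }
  obtain ⟨a, ha⟩ : ∃ a : kˣ, a ≠ 1 := by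
    classical
    obtain ⟨a, ha⟩ := Infinite.exists_notMem_finset ({0, 1} : Finset k)
    simp only [Finset.mem_insert, Finset.mem_singleton, not_or] at ha
    exact ⟨Units.mk0 a ha.1, fun h => ha.2 (congrArg Units.val h)⟩
  have hZ : StrictMono fun j : Fin (Module.finrank ℤ L + 1) => Z j := by
    intro i j hij
    refine lt_of_le_of_ne ?_ ?_
    · rintro _ ⟨t, rfl⟩
      refine ⟨Torus.induced k (P i) t, Torus.ext_monomial fun m => ?_⟩
      simp only [Torus.monomial_induced]
      rw [hPP _ _ _ (le_of_lt hij)]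
    · intro heq
      have hi : (i : ℕ) < Module.finrank ℤ L := by
        have := j.2
        have : (i : ℕ) < j := hij
        omega
      -- The point with its first `j` coordinates equal to `a ≠ 1` and the others equal to 1
      -- separates the two subtori.
      have hmem : Torus.induced k (P j) (Torus.ofBasis b fun _ => a) ∈ Z i := by
        have h1 : Torus.induced k (P j) (Torus.ofBasis b fun _ => a) ∈ Z j := ⟨_, rfl⟩
        rwa [← show Z i = Z j from heq] at h1
      replace hmem : Torus.induced k (P j) (Torus.ofBasis b fun _ => a) ∈
        Set.range (Torus.induced k (P i)) := hmem
      rw [hfix] at hmem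
      have h2 := Set.mem_iInter.1 hmem (b ⟨i, hi⟩)
      rw [Set.mem_ofPred_eq, Torus.monomial_induced, Torus.monomial_induced, hP, hP, if_neg (by simp),
        if_pos (show ((⟨i, hi⟩ : Fin _) : ℕ) < j from hij), map_zero, Torus.monomial_zero,
        Torus.monomial_ofBasis, Finset.prod_eq_single ⟨i, hi⟩] at h2
      · refine ha (Units.ext ?_)
        simpa using h2.symm
      · intro l _ hl
        simp [hl.symm]
      · simp
  exact Order.LTSeries.length_le_krullDim (LTSeries.mk _ _ hZ)

end Dimension

/-! ### Plücker coordinates in an arbitrary basis -/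

section Plucker

variable {k : Type*} [Field k] {n N : ℕ}

theorem pluckerVector_mul (C : Matrix (Fin (n + 1)) (Fin (n + 1)) k)
    (v : Fin (n + 1) → Fin (N + 1) → k) :
    pluckerVector (fun a => ∑ b, C a b • v b) = C.det • pluckerVector v := by
  funext I
  rw [Pi.smul_apply, smul_eq_mul, pluckerVector, pluckerVector, ← Matrix.det_mul]
  congr 1
  ext a b
  simp [Matrix.mul_apply]

theorem plucker_eq_mk (W : Grassmannian k n N) {v : Fin (n + 1) → Fin (N + 1) → k}
    (hv : LinearIndependent k v) (hW : ∀ a, v a ∈ W.1) :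
    plucker W = Projectivization.mk k (pluckerVector v) (pluckerVector_ne_zero hv) := by
  let C : Matrix (Fin (n + 1)) (Fin (n + 1)) k :=
    Matrix.of fun a b => W.basis.repr ⟨v a, hW a⟩ b
  have hC : v = fun a => ∑ b, C a b • (W.basis b : Fin (N + 1) → k) := by
    funext a
    have h := congrArg Subtype.val (W.basis.sum_repr ⟨v a, hW a⟩)
    refine Eq.trans (Eq.symm h) ?_
    rw [Submodule.coe_sum]
    rfl
  have h1 : pluckerVector v = C.det • pluckerVector fun a => (W.basis a : Fin (N + 1) → k) := by
    conv_lhs => rw [hC]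
    exact pluckerVector_mul C _
  have hdet : C.det ≠ 0 := fun h0 => pluckerVector_ne_zero hv (by rw [h1, h0, zero_smul])
  rw [plucker, Projectivization.mk_eq_mk_iff']
  exact ⟨C.det⁻¹, by rw [h1, smul_smul, inv_mul_cancel₀ hdet, one_smul]⟩

end Plucker

/-! ### Embedded tangent spaces -/

section Tangent

variable {k : Type*} [Field k] {N : ℕ}

/-- The chain rule for `f ∘ R`, checked on constants, sums and products with a variable. -/
theorem sum_eval_pderiv_linearSubst {ι κ : Type*} [Fintype ι] [DecidableEq ι] [Fintype κ]
    [DecidableEq κ] (R : (ι → k) →ₗ[k] (κ → k)) (f : MvPolynomial κ k) (x w : ι → k) :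
    ∑ i, MvPolynomial.eval x (MvPolynomial.pderiv i (linearSubst R f)) * w i =
      ∑ j, MvPolynomial.eval (R x) (MvPolynomial.pderiv j f) * R w j := by
  induction f using MvPolynomial.induction_on with
  | C a => simp [linearSubst]
  | add p q hp hq =>
    have : linearSubst R (p + q) = linearSubst R p + linearSubst R q := map_add _ _ _
    simp only [this, map_add, add_mul, Finset.sum_add_distrib, hp, hq]
  | mul_X p l hp =>
    have hL : linearSubst R (p * MvPolynomial.X l) = linearSubst R p *
        ∑ i, MvPolynomial.C (R (Pi.single i 1) l) * MvPolynomial.X i := by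
      simp [linearSubst]
    have hw : ∑ i, R (Pi.single i 1) l * w i = R w l := by
      conv_rhs => rw [pi_eq_sum_univ' w]
      simp [mul_comm]
    have hx : ∑ i, R (Pi.single i 1) l * x i = R x l := by
      conv_rhs => rw [pi_eq_sum_univ' x]
      simp [mul_comm]
    have h1 : ∀ i, MvPolynomial.eval x (MvPolynomial.pderiv i
        (linearSubst R (p * MvPolynomial.X l))) * w i =
        R x l * (MvPolynomial.eval x (MvPolynomial.pderiv i (linearSubst R p)) * w i) +
          MvPolynomial.eval (R x) p * (R (Pi.single i 1) l * w i) := by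
      intro i
      rw [hL, MvPolynomial.pderiv_mul, ← eval_linearSubst, ← hx]
      simp only [map_add, map_mul, map_sum, MvPolynomial.eval_C, MvPolynomial.eval_X,
        MvPolynomial.pderiv_C_mul, MvPolynomial.pderiv_X]
      have : ∑ j, R (Pi.single j 1) l *
          MvPolynomial.eval x (Pi.single (M := fun _ => MvPolynomial ι k) i 1 j) =
          R (Pi.single i 1) l := by
        rw [Finset.sum_eq_single i]
        · simp
        · intro j _ hj; simp [hj]
        · simp
      rw [this]
      ring
    have h2 : ∀ j, MvPolynomial.eval (R x) (MvPolynomial.pderiv j (p * MvPolynomial.X l)) * R w j =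
        R x l * (MvPolynomial.eval (R x) (MvPolynomial.pderiv j p) * R w j) +
          if j = l then MvPolynomial.eval (R x) p * R w j else 0 := by
      intro j
      rw [MvPolynomial.pderiv_mul]
      rcases eq_or_ne j l with rfl | hjl
      · simp; ring
      · simp [hjl, MvPolynomial.pderiv_X_of_ne hjl.symm]; ring
    simp only [h1, h2, Finset.sum_add_distrib, ← Finset.mul_sum, hp, hw]
    simp

theorem sum_eval_smul_pderiv_eq_zero {X : Set (ℙ k (Fin (N + 1) → k))}
    {x : ℙ k (Fin (N + 1) → k)} {w : Fin (N + 1) → k} (hw : w ∈ embeddedTangentSpace X x)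
    {d : ℕ} {f : MvPolynomial (Fin (N + 1)) k} (hf : f.IsHomogeneous d)
    (hX : ∀ y ∈ X, MvPolynomial.eval y.rep f = 0) (c : k) :
    ∑ i, MvPolynomial.eval (c • x.rep) (MvPolynomial.pderiv i f) * w i = 0 := by
  have h := hw d f hf hX
  simp only [eval_smul_of_isHomogeneous hf.pderiv, mul_assoc, ← Finset.mul_sum, h, mul_zero]

theorem finrank_comap_mulVecLin {m : ℕ} {A : Matrix (Fin m) (Fin m) k} (hA : A.det ≠ 0)
    (S : Submodule k (Fin m → k)) :
    Module.finrank k (S.comap A.mulVecLin) = Module.finrank k S := by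
  have hinj : Function.Injective A.mulVecLin :=
    Matrix.mulVec_injective_of_isUnit ((Matrix.isUnit_iff_isUnit_det A).2 hA.isUnit)
  let e := LinearEquiv.ofInjectiveEndo A.mulVecLin hinj
  have h1 : S.comap A.mulVecLin = S.map (e.symm : (Fin m → k) →ₗ[k] (Fin m → k)) :=
    Submodule.comap_equiv_eq_map_symm e S
  rw [h1]
  exact LinearEquiv.finrank_map_eq e.symm S

/-- The image of the Gauss map lies in the closure of its image on any dense set of smooth
points. -/
theorem plucker_gaussMap_mem_closure [Infinite k] {n : ℕ} {X Y : Set (ℙ k (Fin (N + 1) → k))}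
    (hX : topologicalKrullDim X = n) (hXY : X ⊆ closure Y) (hY : Y ⊆ smoothLocus X)
    (y : smoothLocus X) :
    plucker (gaussMap X hX y) ∈
      closure (Set.range fun x : Y => plucker (gaussMap X hX ⟨x.1, hY x.2⟩)) := by
  classical
  let I : Set (MvPolynomial (Fin (N + 1)) k) := {f | ∃ d : ℕ, f.IsHomogeneous d ∧
    ∀ z ∈ X, MvPolynomial.eval z.rep f = 0}
  let grad : MvPolynomial (Fin (N + 1)) k → (Fin (N + 1) → k) :=
    fun f i => MvPolynomial.eval y.1.rep (MvPolynomial.pderiv i f)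
  obtain ⟨b, hbs, hspan, hli⟩ := exists_linearIndependent k (grad '' I)
  have hb : LinearIndepOn k id b := hli
  let E := Module.Basis.extend hb
  have hcard : Nat.card (hb.extend (Set.subset_univ b)) = N + 1 := by
    rw [← Module.finrank_eq_nat_card_basis E]
    simp
  have : Finite (hb.extend (Set.subset_univ b)) := Nat.finite_of_card_ne_zero (by omega)
  let ε : Fin (N + 1) ≃ hb.extend (Set.subset_univ b) := (Finite.equivFinOfCardEq hcard).symm
  choose F hFI hF using fun e : b => hbs e.2
  -- a square matrix of polynomials, whose rows at `y` form a basis, some of its rows being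
  -- the gradients of equations of `X`
  let A : Matrix (Fin (N + 1)) (Fin (N + 1)) (MvPolynomial (Fin (N + 1)) k) :=
    Matrix.of fun i j => if h : (ε i : Fin (N + 1) → k) ∈ b then
      MvPolynomial.pderiv j (F ⟨ε i, h⟩) else MvPolynomial.C ((ε i : Fin (N + 1) → k) j)
  let Aev : (Fin (N + 1) → k) → Matrix (Fin (N + 1)) (Fin (N + 1)) k := fun x =>
    (MvPolynomial.eval x).mapMatrix A
  have hAy : ∀ i, Aev y.1.rep i = ε i := by
    intro i
    funext j
    by_cases h : (ε i : Fin (N + 1) → k) ∈ b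
    · have h1 := congrFun (hF ⟨ε i, h⟩) j
      simp [Aev, A, h]
      exact h1
    · simp [Aev, A, h]
  have hdety : (Aev y.1.rep).det ≠ 0 := by
    have h1 : LinearIndependent k (Aev y.1.rep).row := by
      have h2 : (Aev y.1.rep).row = E ∘ ε := by
        funext i
        rw [Function.comp_apply, Module.Basis.extend_apply_self]
        exact hAy i
      rw [h2]
      exact E.linearIndependent.comp _ ε.injective
    exact ((Matrix.isUnit_iff_isUnit_det _).1
      (Matrix.linearIndependent_rows_iff_isUnit.1 h1)).ne_zero
  -- The tangent space at `z` lies in the preimage of `S` under the matrix at `z`, because the rows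
  -- indexed by `b` are gradients of equations of `X`. At `y` equality holds, as those gradients
  -- span all gradients there.
  let S : Submodule k (Fin (N + 1) → k) :=
    { carrier := {z | ∀ i, (ε i : Fin (N + 1) → k) ∈ b → z i = 0}
      add_mem' := fun {z z'} hz hz' i hi => by simp [hz i hi, hz' i hi]
      zero_mem' := fun i hi => rfl
      smul_mem' := fun c z hz i hi => by simp [hz i hi] }
  have hle : ∀ (z : ℙ k (Fin (N + 1) → k)) (c : k),
      embeddedTangentSpace X z ≤ S.comap (Aev (c • z.rep)).mulVecLin := by
    intro z c w hw i hi
    obtain ⟨d, hd, hdX⟩ := hFI ⟨ε i, hi⟩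
    have h1 := sum_eval_smul_pderiv_eq_zero hw hd hdX c
    rw [← h1]
    simp [Aev, A, hi, Matrix.mulVec, dotProduct]
  have hTy : embeddedTangentSpace X y.1 = S.comap (Aev y.1.rep).mulVecLin := by
    refine le_antisymm (by simpa using hle y.1 1) fun w hw d f hf hfX => ?_
    have hmem : grad f ∈ Submodule.span k b :=
      hspan ▸ Submodule.subset_span ⟨f, ⟨d, hf, hfX⟩, rfl⟩
    have key : ∀ g ∈ Submodule.span k b, ∑ i, g i * w i = 0 := by
      intro g hg
      induction hg using Submodule.span_induction with
      | mem g hg =>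
        let i := ε.symm ⟨g, hb.subset_extend _ hg⟩
        have hεi : (ε i : Fin (N + 1) → k) = g := by simp [i]
        have h1 := hw i (by rw [hεi]; exact hg)
        rw [Matrix.mulVecLin_apply, Matrix.mulVec, hAy, hεi] at h1
        exact h1
      | zero => simp
      | add g g' _ _ h h' => simp [add_mul, Finset.sum_add_distrib, h, h']
      | smul c g _ h => simp [mul_assoc, ← Finset.mul_sum, h]
    exact key _ hmem
  let w := (gaussMap X hX y).basis
  -- Multiplying by the adjugate gives polynomial vectors `P` with `A(x) P(x) = det A(x) · A(y) w`.
  -- Hence they lie in the preimage of `S` under `A(x)` and form a moving basis of the tangent space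
  -- wherever `det A(x) ≠ 0`.
  let P : Fin (n + 1) → Fin (N + 1) → MvPolynomial (Fin (N + 1)) k := fun a =>
    A.adjugate.mulVec fun i => MvPolynomial.C ((Aev y.1.rep).mulVec (w a).1 i)
  let Pev : (Fin (N + 1) → k) → Fin (n + 1) → Fin (N + 1) → k := fun x a =>
    (Aev x).adjugate.mulVec ((Aev y.1.rep).mulVec (w a).1)
  have hPev : ∀ x a j, MvPolynomial.eval x (P a j) = Pev x a j := by
    intro x a j
    simp only [P, Pev, Matrix.mulVec, dotProduct, map_sum, map_mul, MvPolynomial.eval_C]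
    refine Finset.sum_congr rfl fun i _ => ?_
    congr 1
    rw [← RingHom.map_adjugate]
    rfl
  have hAP : ∀ x a, (Aev x).mulVec (Pev x a) =
      (Aev x).det • (Aev y.1.rep).mulVec (w a).1 := by
    intro x a
    simp only [Pev]
    rw [Matrix.mulVec_mulVec, Matrix.mul_adjugate, Matrix.smul_mulVec, Matrix.one_mulVec]
  have hwli : LinearIndependent k fun a => (w a : Fin (N + 1) → k) :=
    w.linearIndependent.map' (Submodule.subtype _) (Submodule.ker_subtype _)
  have hPli : ∀ x, (Aev x).det ≠ 0 → LinearIndependent k (Pev x) := by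
    intro x hx
    have h1 := hwli.map' ((Aev x).adjugate * Aev y.1.rep).mulVecLin (by
      rw [LinearMap.ker_eq_bot]
      refine Matrix.mulVec_injective_of_isUnit ((Matrix.isUnit_iff_isUnit_det _).2 ?_)
      rw [Matrix.det_mul, Matrix.det_adjugate]
      exact (mul_ne_zero (pow_ne_zero _ hx) hdety).isUnit)
    have h2 : Pev x = ((Aev x).adjugate * Aev y.1.rep).mulVecLin ∘
        fun a => (w a : Fin (N + 1) → k) := by
      funext a
      simp [Pev, Matrix.mulVec_mulVec]
    rw [h2]
    exact h1
  have hplucker : ∀ (z : smoothLocus X) (c : k)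
      (hdet : (Aev (c • z.1.rep)).det ≠ 0), plucker (gaussMap X hX z) =
        Projectivization.mk k _ (pluckerVector_ne_zero (hPli _ hdet)) := by
    intro z c hdet
    refine plucker_eq_mk _ (hPli _ hdet) fun a => ?_
    -- When the determinant is nonzero, the preimage of `S` has the dimension it has at `y`, namely
    -- `n + 1`, which is also that of the tangent space at the smooth point `z`.
    have heq : embeddedTangentSpace X z.1 = S.comap (Aev (c • z.1.rep)).mulVecLin := by
      refine Submodule.eq_of_le_of_finrank_eq (hle _ _) ?_
      rw [finrank_comap_mulVecLin hdet, ← finrank_comap_mulVecLin hdety S, ← hTy]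
      exact (gaussMap X hX z).2.trans (gaussMap X hX y).2.symm
    change Pev _ a ∈ embeddedTangentSpace X z.1
    rw [heq, Submodule.mem_comap, Matrix.mulVecLin_apply, hAP]
    refine S.smul_mem _ ?_
    have h1 : (w a).1 ∈ embeddedTangentSpace X y.1 := (w a).2
    rw [hTy] at h1
    exact h1
  refine mem_closure_iff_eval.2 fun d G hG hGY => ?_
  -- The factor `det A` makes `H` vanish also where the moving basis degenerates. `H` need not be
  -- homogeneous, so its vanishing is tested on the whole cone over `Y`.
  let H : MvPolynomial (Fin (N + 1)) k := A.det * MvPolynomial.aeval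
    (fun J : Fin (n + 1) ↪o Fin (N + 1) => Matrix.det (Matrix.of fun a c => P a (J c))) G
  have hH : ∀ x, MvPolynomial.eval x H =
      (Aev x).det * MvPolynomial.eval (pluckerVector (Pev x)) G := by
    intro x
    simp only [H, map_mul]
    congr 1
    · exact RingHom.map_det _ _
    · rw [MvPolynomial.aeval_def, MvPolynomial.eval_eval₂, ← MvPolynomial.eval₂_id]
      congr 1
      · ext; simp
      · funext J
        rw [RingHom.map_det, pluckerVector]
        congr 1
        ext a c
        exact hPev x a (J c)
  have h0 := eval_rep_eq_zero_of_mem_closure (hXY y.2.1) H (by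
    intro z hz c hc
    rw [hH, mul_eq_zero, or_iff_not_imp_left]
    intro hdet
    have h1 : MvPolynomial.eval (plucker (gaussMap X hX ⟨z, hY hz⟩)).rep G = 0 :=
      hGY _ ⟨⟨z, hz⟩, rfl⟩
    rwa [hplucker ⟨z, hY hz⟩ c hdet, eval_rep_mk_eq_zero hG] at h1)
  rw [hH, mul_eq_zero, or_iff_right hdety] at h0
  have hdety' : (Aev ((1 : k) • y.1.rep)).det ≠ 0 := by rwa [one_smul]
  rw [hplucker y 1 hdety', eval_rep_mk_eq_zero hG, one_smul]
  exact h0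

end Tangent

/-! ### Tangent spaces of toric varieties -/

section ToricTangent

variable {k : Type*} [Field k] {M : Type*} [AddCommGroup M] {n N : ℕ}

/-- The matrix whose columns are the homogeneous coordinates `(1, u_j)` of the points `u_j` in
a basis of the lattice. -/
def coordMatrix (k : Type*) [Field k] {ι : Type*} (β : Module.Basis (Fin n) ℤ M) (u : ι → M) :
    Matrix (Fin (n + 1)) ι k :=
  Matrix.of (Fin.cons (fun _ => 1) fun a j => ((β.repr (u j) a : ℤ) : k))

@[simp] theorem coordMatrix_zero {ι : Type*} (β : Module.Basis (Fin n) ℤ M) (u : ι → M) (j : ι) :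
    coordMatrix k β u 0 j = 1 := rfl

@[simp] theorem coordMatrix_succ {ι : Type*} (β : Module.Basis (Fin n) ℤ M) (u : ι → M)
    (a : Fin n) (j : ι) : coordMatrix k β u a.succ j = ((β.repr (u j) a : ℤ) : k) := rfl

theorem sum_coordMatrix_succ {ι : Type*} [Fintype ι] (β : Module.Basis (Fin n) ℤ M) (u : ι → M)
    (m : ι → ℤ) (a : Fin n) :
    ∑ j, (m j : k) * coordMatrix k β u a.succ j = ((β.repr (∑ j, m j • u j) a : ℤ) : k) := by
  simp [map_sum]

/-- A basis of the tangent space at a point of the torus. -/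
def tangentRows (β : Module.Basis (Fin n) ℤ M) (u : Fin (N + 1) → M) (t : Torus k M) :
    Fin (n + 1) → Fin (N + 1) → k :=
  fun a j => Torus.monomial (u j) t * coordMatrix k β u a j

variable (β : Module.Basis (Fin n) ℤ M) {u : Fin (N + 1) → M}

theorem exists_sum_eq_one (hu : ∀ m, ∃ a : Fin (N + 1) → ℤ, ∑ i, a i = 0 ∧ ∑ i, a i • u i = m)
    (m : M) : ∃ a : Fin (N + 1) → ℤ, ∑ i, a i = 1 ∧ ∑ i, a i • u i = m := by
  obtain ⟨a, ha0, ha⟩ := hu (m - u 0)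
  refine ⟨a + Pi.single 0 1, ?_, ?_⟩
  · simp [Finset.sum_add_distrib, ha0]
  · simp [add_smul, Finset.sum_add_distrib, ha, Pi.single_apply]

/-- A relation among the rows is an affine function with coefficients in `k` that vanishes at every
`u_j`. The `u_j` span the affine lattice over ℤ, so it vanishes at 0 and at the basis vectors,
whatever the characteristic. -/
theorem tangentRows_linearIndependent
    (hu : ∀ m, ∃ a : Fin (N + 1) → ℤ, ∑ i, a i = 0 ∧ ∑ i, a i • u i = m) (t : Torus k M) :
    LinearIndependent k (tangentRows β u t) := by
  refine Fintype.linearIndependent_iff.2 fun g hg => ?_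
  have h1 : ∀ j, ∑ a, g a * coordMatrix k β u a j = 0 := fun j => by
    have h2 := congrFun hg j
    simp only [Finset.sum_apply, Pi.smul_apply, smul_eq_mul, tangentRows, Pi.zero_apply] at h2
    have h3 : Torus.monomial (u j) t * ∑ a, g a * coordMatrix k β u a j = 0 := by
      rw [← h2, Finset.mul_sum]
      exact Finset.sum_congr rfl fun a _ => by ring
    exact (mul_eq_zero.1 h3).resolve_left (Torus.monomial_ne_zero _ _)
  have h4 : ∀ m : Fin (N + 1) → ℤ, g 0 * ((∑ j, m j : ℤ) : k) +
      ∑ a : Fin n, g a.succ * ((β.repr (∑ j, m j • u j) a : ℤ) : k) = 0 := by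
    intro m
    have h5 : ∑ j, (m j : k) * ∑ a, g a * coordMatrix k β u a j = 0 := by simp [h1]
    rw [← h5]
    simp only [Fin.sum_univ_succ (n := n), ← sum_coordMatrix_succ, mul_add, Finset.sum_add_distrib,
      Int.cast_sum, Finset.mul_sum, coordMatrix_zero]
    congr 1
    · exact Finset.sum_congr rfl fun j _ => by ring
    · rw [Finset.sum_comm]
      exact Finset.sum_congr rfl fun j _ => Finset.sum_congr rfl fun a _ => by ring
  intro a
  refine Fin.cases ?_ (fun a => ?_) a
  · obtain ⟨m, hm1, hm⟩ := exists_sum_eq_one hu 0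
    simpa [hm1, hm] using h4 m
  · obtain ⟨m, hm0, hm⟩ := hu (β a)
    have h6 := h4 m
    rw [hm0, hm] at h6
    simpa [Finsupp.single_apply] using h6

theorem eval_mul_pderiv_monomial {ι : Type*} [Fintype ι] (x : ι → k) (m : ι →₀ ℕ) (c : k)
    (i : ι) : MvPolynomial.eval x (MvPolynomial.pderiv i (MvPolynomial.monomial m c)) * x i =
      m i * (c * ∏ j, x j ^ m j) := by
  have h := congrArg (MvPolynomial.eval x)
    (MvPolynomial.X_mul_pderiv_monomial (i := i) (m := m) (r := c))
  rw [map_mul, MvPolynomial.eval_X, map_nsmul, MvPolynomial.eval_monomial,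
    Finsupp.prod_fintype _ _ (fun i => pow_zero _), nsmul_eq_mul] at h
  rw [mul_comm, h]

theorem monomialSubst_monomial {ι : Type*} [Fintype ι] (c : ι → k) (v : ι → M) (m : ι →₀ ℕ)
    (r : k) : monomialSubst c v (MvPolynomial.monomial m r) =
      AddMonoidAlgebra.single (∑ i, m i • v i) (r * ∏ i, c i ^ m i) := by
  rw [monomialSubst, MvPolynomial.aeval_monomial, Finsupp.prod_fintype _ _ (fun i => pow_zero _)]
  simp only [AddMonoidAlgebra.single_pow, AddMonoidAlgebra.prod_single]
  rw [← Algebra.smul_def, AddMonoidAlgebra.smul_single, smul_eq_mul]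

/-- The logarithmic derivative of `f(c_i z^{v_i})` in the direction `μ`, evaluated at `t`. -/
theorem sum_eval_pderiv_mul {ι : Type*} [Fintype ι] (c : ι → k) (v : ι → M) (μ : M →+ k)
    (t : Torus k M) (f : MvPolynomial ι k) :
    ∑ i, MvPolynomial.eval (fun i => c i * Torus.monomial (v i) t) (MvPolynomial.pderiv i f) *
        ((c i * Torus.monomial (v i) t) * μ (v i)) =
      (monomialSubst c v f).coeff.sum fun m r => r * (μ m * Torus.monomial m t) := by
  induction f using MvPolynomial.induction_on' with
  | monomial m r =>
    rw [monomialSubst_monomial, AddMonoidAlgebra.coeff_single, Finsupp.sum_single_index (by simp)]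
    simp only [← mul_assoc, eval_mul_pderiv_monomial (fun i => c i * Torus.monomial (v i) t)]
    simp only [mul_pow, Finset.prod_mul_distrib, Torus.monomial_sum, Torus.monomial_nsmul,
      map_sum, map_nsmul, nsmul_eq_mul, Finset.mul_sum, Finset.sum_mul]
    exact Finset.sum_congr rfl fun i _ => by ring
  | add p q hp hq =>
    rw [map_add, AddMonoidAlgebra.coeff_add, Finsupp.sum_add_index' (by simp) (by intros; ring),
      ← hp, ← hq, ← Finset.sum_add_distrib]
    exact Finset.sum_congr rfl fun i _ => by rw [map_add, map_add, add_mul]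

/-- For the row of ones this is Euler's formula. For the other rows, an equation of `X_A` becomes
the zero Laurent polynomial after substitution of the monomials, so its logarithmic derivative in
each coordinate direction is zero. -/
theorem tangentRows_mem [Infinite k] [Module.Free ℤ M] [Module.Finite ℤ M] (t : Torus k M)
    (a : Fin (n + 1)) :
    tangentRows β u t a ∈ embeddedTangentSpace (toricVariety k u) (torusMap k u t) := by
  intro d f hf hX
  obtain ⟨c, hc, hrep⟩ := exists_rep_torusMap u t
  have hx : (torusMap k u t).rep = fun i => c * Torus.monomial (u i) t := funext hrep
  have key : ∑ i, MvPolynomial.eval (torusMap k u t).rep (MvPolynomial.pderiv i f) *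
      ((torusMap k u t).rep i * coordMatrix k β u a i) = 0 := by
    refine Fin.cases ?_ (fun a => ?_) a
    · have h1 := congrArg (MvPolynomial.eval (torusMap k u t).rep) hf.sum_X_mul_pderiv
      simp only [map_sum, map_mul, MvPolynomial.eval_X, map_nsmul,
        hX _ (subset_closure ⟨t, rfl⟩), smul_zero] at h1
      rw [← h1]
      exact Finset.sum_congr rfl fun i _ => by rw [coordMatrix_zero]; ring
    · let μ : M →+ k := (Int.castAddHom k).comp (β.coord a).toAddMonoidHom
      have h0 : monomialSubst (fun _ => c) u f = 0 := Torus.eq_zero_of_eval_eq_zero fun s => by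
        rw [eval_monomialSubst]
        have h1 := (eval_rep_torusMap_eq_zero u s hf).1 (hX _ (subset_closure ⟨s, rfl⟩))
        have h2 := eval_smul_of_isHomogeneous hf c fun i => Torus.monomial (u i) s
        rw [h1, mul_zero] at h2
        exact h2
      have h3 := sum_eval_pderiv_mul (fun _ => c) u μ t f
      rw [h0] at h3
      simp only [hx]
      exact h3.trans (by simp)
  rw [← mul_right_inj' hc, mul_zero, ← key, Finset.mul_sum]
  refine Finset.sum_congr rfl fun i _ => ?_
  rw [hrep i, tangentRows]
  ring

/-- This is tangency to the binomial equation attached to the relation `m`: at a point where `x^a =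
x^b ≠ 0`, the differential of `x^a - x^b` is `x^a ∑ m_i dx_i / x_i`. -/
theorem sum_mul_eq_zero_of_mem_embeddedTangentSpace {x w : Fin (N + 1) → k} {t : Torus k M}
    (hw : w ∈ embeddedTangentSpace (toricVariety k u) (torusMap k u t)) {m : Fin (N + 1) → ℤ}
    (hm : ∑ i, m i = 0) (hmu : ∑ i, m i • u i = 0)
    (hx : x = (torusMap k u t).rep) : ∑ i, (m i : k) * (w i / x i) = 0 := by
  subst hx
  set x := (torusMap k u t).rep with hxdef
  have hx0 : ∀ i, x i ≠ 0 := rep_torusMap_ne_zero u t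
  let a : Fin (N + 1) → ℕ := fun i => (m i).toNat
  let b : Fin (N + 1) → ℕ := fun i => (-m i).toNat
  have hab : ∀ i, (a i : ℤ) - b i = m i := fun i => by simp only [a, b]; omega
  have h1 : ∑ i, a i = ∑ i, b i := by
    zify
    rw [← sub_eq_zero, ← Finset.sum_sub_distrib, ← hm]
    exact Finset.sum_congr rfl fun i _ => hab i
  have h2 : ∑ i, a i • u i = ∑ i, b i • u i := by
    rw [← sub_eq_zero, ← Finset.sum_sub_distrib, ← hmu]
    refine Finset.sum_congr rfl fun i _ => ?_
    rw [← natCast_zsmul, ← natCast_zsmul, ← sub_smul, hab]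
  have h3 := hw _ _ (binomial_isHomogeneous (k := k) h1) fun y hy => eval_binomial_eq_zero h1 h2 hy
  have h4 : ∏ i, x i ^ a i = ∏ i, x i ^ b i := by
    have := eval_binomial_eq_zero h1 h2 (subset_closure ⟨t, rfl⟩ : torusMap k u t ∈ toricVariety k u)
    rwa [eval_binomial, sub_eq_zero] at this
  have hne : ∏ i, x i ^ a i ≠ 0 := Finset.prod_ne_zero_iff.2 fun i _ => pow_ne_zero _ (hx0 i)
  rw [← mul_right_inj' hne, mul_zero, ← h3, Finset.mul_sum]
  refine Finset.sum_congr rfl fun i _ => ?_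
  have h5 : MvPolynomial.eval x (MvPolynomial.pderiv i (binomial k a b)) * x i =
      m i * ∏ i, x i ^ a i := by
    rw [binomial, map_sub, map_sub, sub_mul, eval_mul_pderiv_monomial, eval_mul_pderiv_monomial,
      ← hab i]
    simp only [Finsupp.coe_equivFunOnFinite_symm, ← h4]
    push_cast
    ring
  rw [← hxdef]
  calc (∏ i, x i ^ a i) * (m i * (w i / x i)) =
      (m i * ∏ i, x i ^ a i) * (w i / x i) := by ring
    _ = _ := by rw [← h5]; field_simp [hx0 i]

/-- For a tangent vector `w` the binomials force `w_j / x_j` to respect all affine relations among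
the `u_j`. So `w_j / x_j` is the value at `u_j` of an affine function, hence a combination of the
rows. -/
theorem embeddedTangentSpace_torusMap [Infinite k] [Module.Free ℤ M] [Module.Finite ℤ M]
    (hu : ∀ m, ∃ a : Fin (N + 1) → ℤ, ∑ i, a i = 0 ∧ ∑ i, a i • u i = m) (t : Torus k M) :
    embeddedTangentSpace (toricVariety k u) (torusMap k u t) =
      Submodule.span k (Set.range (tangentRows β u t)) := by
  refine le_antisymm (fun w hw => ?_) (Submodule.span_le.2 ?_)
  · obtain ⟨c, hc, hrep⟩ := exists_rep_torusMap u t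
    set x := (torusMap k u t).rep with hx
    obtain ⟨p, hp1, hp⟩ := exists_sum_eq_one hu 0
    choose q hq0 hq using fun a => hu (β a)
    -- The coefficients of this affine function: its value at 0 and its linear part on the basis,
    -- read off from integer combinations of the `u_i` that represent them.
    let g : Fin (n + 1) → k := Fin.cons (∑ i, (p i : k) * (w i / x i))
      fun a => ∑ i, (q a i : k) * (w i / x i)
    have hg : ∀ j, w j / x j = ∑ a, g a * coordMatrix k β u a j := by
      intro j
      have h1 := sum_mul_eq_zero_of_mem_embeddedTangentSpace hw
        (m := Pi.single j 1 - p - ∑ a, β.repr (u j) a • q a)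
        (by
          simp only [Pi.sub_apply, Finset.sum_apply, Pi.smul_apply, Finset.sum_sub_distrib, hp1,
            smul_eq_mul]
          rw [Finset.sum_comm]
          simp [← Finset.mul_sum, hq0])
        (by
          simp only [Pi.sub_apply, Finset.sum_apply, Pi.smul_apply, sub_smul, Finset.sum_smul,
            Finset.sum_sub_distrib, hp, smul_eq_mul, mul_smul]
          rw [Finset.sum_comm]
          simp only [← Finset.smul_sum, hq, β.sum_repr]
          simp [Pi.single_apply])
        hx
      simp only [Pi.sub_apply, Finset.sum_apply, Pi.smul_apply, smul_eq_mul, Int.cast_sub,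
        Int.cast_sum, Int.cast_mul, sub_mul, Finset.sum_sub_distrib, Finset.sum_mul] at h1
      rw [Finset.sum_comm] at h1
      have h2 : ∑ i, ((Pi.single j (1 : ℤ) : Fin (N + 1) → ℤ) i : k) * (w i / x i) = w j / x j := by
        simp [Pi.single_apply]
      rw [h2, sub_sub, sub_eq_zero] at h1
      rw [h1, Fin.sum_univ_succ (n := n)]
      congr 1
      · simp [g]
      · refine Finset.sum_congr rfl fun a _ => ?_
        simp only [g, Fin.cons_succ, coordMatrix_succ, Finset.sum_mul]
        exact Finset.sum_congr rfl fun i _ => by ring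
    have hw' : w = ∑ a, (c * g a) • tangentRows β u t a := by
      funext j
      have hxj : x j ≠ 0 := rep_torusMap_ne_zero u t j
      rw [← div_mul_cancel₀ (w j) hxj, hg j, hrep j, Finset.sum_mul]
      simp only [Finset.sum_apply, Pi.smul_apply, smul_eq_mul, tangentRows]
      exact Finset.sum_congr rfl fun a _ => by ring
    rw [hw']
    exact Submodule.sum_mem _ fun a _ =>
      Submodule.smul_mem _ _ (Submodule.subset_span ⟨a, rfl⟩)
  · rintro _ ⟨a, rfl⟩
    exact tangentRows_mem β t a

/-- Torus elements carry embedded tangent spaces to embedded tangent spaces. -/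
theorem mul_mem_embeddedTangentSpace {t : Torus k M} {c : k} {y y' : ℙ k (Fin (N + 1) → k)}
    (hy : ∀ i, y'.rep i = c * Torus.monomial (u i) t * y.rep i) {w : Fin (N + 1) → k}
    (hw : w ∈ embeddedTangentSpace (toricVariety k u) y) :
    (fun i => Torus.monomial (u i) t * w i) ∈ embeddedTangentSpace (toricVariety k u) y' := by
  intro d f hf hX
  have hc : c ≠ 0 := by
    rintro rfl
    exact y'.rep_nonzero (funext fun i => by simp [hy])
  let R : (Fin (N + 1) → k) →ₗ[k] (Fin (N + 1) → k) :=
    LinearMap.mulLeft k fun i => c * Torus.monomial (u i) t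
  have hR : ∀ x i, R x i = c * Torus.monomial (u i) t * x i := fun x i => rfl
  have h1 := hw d (linearSubst R f) (linearSubst_isHomogeneous R hf) (by
    intro z hz
    refine mem_closure_iff_eval.1 hz d _ (linearSubst_isHomogeneous R hf) ?_
    rintro _ ⟨s, rfl⟩
    obtain ⟨b, hb, hs⟩ := exists_rep_torusMap u s
    have h2 := (eval_rep_torusMap_eq_zero u (t * s) hf).1 (hX _ (subset_closure ⟨t * s, rfl⟩))
    have h3 := eval_smul_of_isHomogeneous hf (c * b) fun i => Torus.monomial (u i) (t * s)
    rw [h2, mul_zero] at h3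
    rw [eval_linearSubst, ← h3]
    congr 2
    funext i
    rw [hR, hs, Pi.smul_apply, smul_eq_mul, Torus.monomial_mul]
    ring)
  rw [sum_eval_pderiv_linearSubst] at h1
  have h4 : R y.rep = y'.rep := funext fun i => (hy i).symm
  rw [h4] at h1
  rw [← mul_right_inj' hc, mul_zero, ← h1, Finset.mul_sum]
  exact Finset.sum_congr rfl fun i _ => by rw [hR]; ring

end ToricTangent

/-! ### The lattice points `B` and the Gauss map on the torus -/

section SpanningSums

variable {k : Type*} [Field k] {M : Type*} [AddCommGroup M] {n N : ℕ}

/-- The minor of the matrix of homogeneous coordinates on the columns `J`. -/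
def coordMinor (k : Type*) [Field k] {ι : Type*} (β : Module.Basis (Fin n) ℤ M) (u : ι → M)
    (J : Fin (n + 1) → ι) : k :=
  ((coordMatrix k β u).submatrix id J).det

/-- A left kernel vector of the minor is an affine function that vanishes on the chosen points, and
spanning makes it zero. Conversely, an invertible minor allows one to solve for the coefficients of
any vector. -/
theorem affineSpan_eq_top_iff {ι : Type*} (β : Module.Basis (Fin n) ℤ M) (u : ι → M)
    (J : Fin (n + 1) → ι) :
    affineSpan k (Set.range fun j => (1 : k) ⊗ₜ[ℤ] u (J j)) = ⊤ ↔ coordMinor k β u J ≠ 0 := by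
  let e := Algebra.TensorProduct.basis k β
  have he : ∀ m a, e.repr ((1 : k) ⊗ₜ[ℤ] m) a = ((β.repr m a : ℤ) : k) := fun m a => by
    simp [e, Algebra.TensorProduct.basis_repr_tmul]
  rw [AffineSubspace.affineSpan_eq_top_iff_vectorSpan_eq_top_of_nonempty k _ _
    (Set.range_nonempty _), vectorSpan_range_eq_span_range_vsub_right k _ (0 : Fin (n + 1))]
  simp only [vsub_eq_sub]
  constructor
  · intro htop hdet
    obtain ⟨g, hg0, hg⟩ := Matrix.exists_vecMul_eq_zero_iff.2 hdet
    have hg' : ∀ j, g 0 + ∑ a : Fin n, g a.succ * ((β.repr (u (J j)) a : ℤ) : k) = 0 := fun j => by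
      have h1 := congrFun hg j
      simpa [Matrix.vecMul, dotProduct, Fin.sum_univ_succ] using h1
    let μ : k ⊗[ℤ] M →ₗ[k] k := ∑ a : Fin n, g a.succ • e.coord a
    have hμ : ∀ x, μ x = ∑ a : Fin n, g a.succ * e.repr x a := fun x => by
      simp [μ, LinearMap.sum_apply]
    have hker : (⊤ : Submodule k (k ⊗[ℤ] M)) ≤ LinearMap.ker μ := by
      rw [← htop, Submodule.span_le]
      rintro _ ⟨j, rfl⟩
      rw [SetLike.mem_coe, LinearMap.mem_ker, map_sub, hμ, hμ]
      simp only [he]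
      linear_combination hg' j - hg' 0
    have hsucc : ∀ a : Fin n, g a.succ = 0 := fun a => by
      have h2 : μ (e a) = 0 := hker Submodule.mem_top
      rw [hμ] at h2
      simpa [Finsupp.single_apply] using h2
    refine hg0 (funext fun a => Fin.cases ?_ hsucc a)
    simpa [hsucc] using hg' 0
  · intro hdet
    rw [eq_top_iff]
    intro x _
    let A := (coordMatrix k β u).submatrix id J
    -- The leading 0 makes the coefficients sum to zero, so that `x` is a combination of differences
    -- of the points.
    let z : Fin (n + 1) → k := Fin.cons 0 fun a => e.repr x a
    let w := A⁻¹.mulVec z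
    have hw : A.mulVec w = z := by
      rw [Matrix.mulVec_mulVec, Matrix.mul_nonsing_inv _ (isUnit_iff_ne_zero.2 hdet),
        Matrix.one_mulVec]
    have hw0 : ∑ j, w j = 0 := by
      have h1 := congrFun hw 0
      simpa [Matrix.mulVec, dotProduct, A, z] using h1
    have hx : x = ∑ j, w j • ((1 : k) ⊗ₜ[ℤ] u (J j) - (1 : k) ⊗ₜ[ℤ] u (J 0)) := by
      simp only [smul_sub, Finset.sum_sub_distrib, ← Finset.sum_smul, hw0, zero_smul, sub_zero]
      refine e.repr.injective (Finsupp.ext fun a => ?_)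
      have h1 := congrFun hw a.succ
      simp only [Matrix.mulVec, dotProduct, A, z, Matrix.submatrix_apply, id, coordMatrix_succ,
        Fin.cons_succ] at h1
      rw [← h1]
      simp only [map_sum, map_smul, Finsupp.coe_finsetSum, Finset.sum_apply, Finsupp.smul_apply, he,
        smul_eq_mul]
      exact Finset.sum_congr rfl fun j _ => mul_comm _ _
    rw [hx]
    exact Submodule.sum_mem _ fun j _ => Submodule.smul_mem _ _ (Submodule.subset_span ⟨j, rfl⟩)

theorem mem_spanningSums {ι : Type*} (β : Module.Basis (Fin n) ℤ M) (u : ι → M) {b : M} :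
    b ∈ spanningSums k u n ↔
      ∃ J : Fin (n + 1) → ι, coordMinor k β u J ≠ 0 ∧ b = ∑ j, u (J j) := by
  simp only [spanningSums, Set.mem_ofPred_eq, affineSpan_eq_top_iff β]

theorem spanningSums_finite {ι : Type*} [Finite ι] (u : ι → M) : (spanningSums k u n).Finite := by
  refine (Set.finite_range fun J : Fin (n + 1) → ι => ∑ j, u (J j)).subset ?_
  rintro _ ⟨J, -, rfl⟩
  exact ⟨J, rfl⟩

variable (β : Module.Basis (Fin n) ℤ M) (u : Fin (N + 1) → M)

theorem exists_orderEmbedding_of_coordMinor_ne_zero {J : Fin (n + 1) → Fin (N + 1)}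
    (hJ : coordMinor k β u J ≠ 0) : ∃ I : Fin (n + 1) ↪o Fin (N + 1),
      coordMinor k β u I ≠ 0 ∧ ∑ j, u (I j) = ∑ j, u (J j) := by
  have hinj : Function.Injective J := by
    intro a b hab
    by_contra hne
    exact hJ (Matrix.det_zero_of_column_eq hne fun c => by simp [hab])
  have hs : StrictMono (J ∘ Tuple.sort J) :=
    (Tuple.monotone_sort J).strictMono_of_injective (hinj.comp (Tuple.sort J).injective)
  refine ⟨OrderEmbedding.ofStrictMono _ hs, ?_, ?_⟩
  · have h3 := Matrix.det_permute' (Tuple.sort J) ((coordMatrix k β u).submatrix id J)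
    have h4 : coordMinor k β u (OrderEmbedding.ofStrictMono _ hs) =
        (((coordMatrix k β u).submatrix id J).submatrix id (Tuple.sort J)).det := rfl
    rw [h4, h3]
    refine mul_ne_zero ?_ hJ
    rcases Int.units_eq_one_or (Equiv.Perm.sign (Tuple.sort J)) with h | h <;> simp [h]
  · exact Equiv.sum_comp (Tuple.sort J) fun j => u (J j)

/-- Column `j` of the matrix carries the common factor `z^{u_j}(t)`, so the minor splits into a
monomial and a constant. -/
theorem pluckerVector_tangentRows (t : Torus k M) (I : Fin (n + 1) ↪o Fin (N + 1)) :
    pluckerVector (tangentRows β u t) I =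
      Torus.monomial (∑ j, u (I j)) t * coordMinor k β u I := by
  rw [Torus.monomial_sum, coordMinor, ← Matrix.det_mul_row]
  rfl

theorem sum_update (I : Fin (n + 1) → Fin (N + 1)) (a : Fin (n + 1)) (j : Fin (N + 1)) :
    ∑ b, u (Function.update I a j b) = ∑ b, u (I b) + (u j - u (I a)) := by
  rw [← sub_eq_iff_eq_add', ← Finset.sum_sub_distrib, Finset.sum_eq_single a]
  · simp
  · intro b _ hb
    simp [hb]
  · simp

/-- Row reduction by Cramer's rule: the row space of `Q` is spanned by the rows `V a`, whose entries
are the minors with the column `I a` exchanged for `j`. If such a minor is nonzero, the exchange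
stays in `B` and changes the sum by `u_j - u_{I a}`, so `z^{u_j - u_{I a}}` agrees at `s` and `t`.
The row `V a` scaled by `t` is therefore a multiple of the one scaled by `s`. -/
theorem tangentRows_mem_span_of_monomial_eq {s t : Torus k M}
    (h : ∀ b ∈ spanningSums k u n, ∀ b' ∈ spanningSums k u n,
      Torus.monomial (b - b') t = Torus.monomial (b - b') s)
    {I : Fin (n + 1) → Fin (N + 1)} (hI : coordMinor k β u I ≠ 0) (b : Fin (n + 1)) :
    tangentRows β u t b ∈ Submodule.span k (Set.range (tangentRows β u s)) := by
  let Q := coordMatrix k β u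
  let A := Q.submatrix id I
  let V : Fin (n + 1) → Fin (N + 1) → k := fun a j => A.cramer (fun c => Q c j) a
  have hV : ∀ a j, V a j = coordMinor k β u (Function.update I a j) := by
    intro a j
    simp only [V, Matrix.cramer_apply, coordMinor]
    congr 1
    ext c d
    by_cases hd : d = a
    · subst hd; simp [Q]
    · simp [A, Q, hd]
  have hAV : ∀ j, ∑ a, Q b (I a) * V a j = coordMinor k β u I * Q b j := by
    intro j
    have h1 := congrFun (Matrix.mulVec_cramer A fun c => Q c j) b
    simp only [Matrix.mulVec, dotProduct, Pi.smul_apply, smul_eq_mul] at h1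
    exact h1
  have hVQ : ∀ a j, V a j = ∑ c, A.adjugate a c * Q c j := by
    intro a j
    simp only [V, Matrix.cramer_eq_adjugate_mulVec, Matrix.mulVec, dotProduct]
  have hts : ∀ a j, Torus.monomial (u j) t * V a j =
      Torus.monomial (u (I a)) t / Torus.monomial (u (I a)) s *
        (Torus.monomial (u j) s * V a j) := by
    intro a j
    by_cases h0 : V a j = 0
    · simp [h0]
    have h1 := h _ ((mem_spanningSums β u).2 ⟨_, (hV a j) ▸ h0, rfl⟩) _
      ((mem_spanningSums β u).2 ⟨I, hI, rfl⟩)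
    rw [sum_update, add_sub_cancel_left, Torus.monomial_sub, Torus.monomial_sub] at h1
    have h2 := Torus.monomial_ne_zero (u (I a)) t
    have h3 := Torus.monomial_ne_zero (u (I a)) s
    field_simp at h1 ⊢
    linear_combination h1
  have hrow : tangentRows β u t b = ∑ a, ∑ c, ((coordMinor k β u I)⁻¹ * Q b (I a) *
      (Torus.monomial (u (I a)) t / Torus.monomial (u (I a)) s) * A.adjugate a c) •
        tangentRows β u s c := by
    funext j
    simp only [Finset.sum_apply, Pi.smul_apply, smul_eq_mul, tangentRows]
    have h1 : Torus.monomial (u j) t * Q b j = (coordMinor k β u I)⁻¹ *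
        ∑ a, Q b (I a) * (Torus.monomial (u j) t * V a j) := by
      rw [eq_inv_mul_iff_mul_eq₀ hI]
      have h2 := hAV j
      calc coordMinor k β u I * (Torus.monomial (u j) t * Q b j) =
          Torus.monomial (u j) t * (coordMinor k β u I * Q b j) := by ring
        _ = _ := by
          rw [← h2, Finset.mul_sum]
          exact Finset.sum_congr rfl fun a _ => by ring
    refine h1.trans ?_
    rw [Finset.mul_sum]
    refine Finset.sum_congr rfl fun a _ => ?_
    rw [hts, hVQ, Finset.mul_sum, Finset.mul_sum, Finset.mul_sum, Finset.mul_sum]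
    exact Finset.sum_congr rfl fun c _ => by simp only [Q]; ring
  rw [hrow]
  exact Submodule.sum_mem _ fun a _ => Submodule.sum_mem _ fun c _ =>
    Submodule.smul_mem _ _ (Submodule.subset_span ⟨c, rfl⟩)

end SpanningSums

/-! ### Saturations -/

section Saturation

variable {M : Type*} [AddCommGroup M]

theorem induced_subtype_eq_iff {k : Type*} [Field k] (S : Set M) (s t : Torus k M) :
    Torus.induced k (diffLattice S).subtype s = Torus.induced k (diffLattice S).subtype t ↔
      ∀ b ∈ S, ∀ b' ∈ S, Torus.monomial (b - b') s = Torus.monomial (b - b') t := by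
  constructor
  · intro h b hb b' hb'
    exact congrArg (Torus.monomial (⟨b - b',
      AddSubgroup.subset_closure (Set.sub_mem_sub hb hb')⟩ : diffLattice S)) h
  · intro h
    refine Torus.ext_monomial fun m => ?_
    obtain ⟨m, hm⟩ := m
    change Torus.monomial m s = Torus.monomial m t
    induction hm using AddSubgroup.closure_induction with
    | mem x hx =>
      obtain ⟨b, hb, b', hb', rfl⟩ := hx
      exact h b hb b' hb'
    | zero => simp
    | add x y _ _ hx hy => rw [Torus.monomial_add, Torus.monomial_add, hx, hy]
    | neg x _ hx => rw [Torus.monomial_neg, Torus.monomial_neg, hx]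

/-- If no multiple of `m` lies in `⟨S - S⟩`, then `m` survives in the quotient modulo torsion, which
is free. A coordinate there extends to a real functional that kills `S - S` but not `m`. -/
theorem mem_realSaturation_iff [Module.Finite ℤ M] {S : Set M} {m : M} :
    m ∈ realSaturation S ↔ ∃ e : ℕ, e ≠ 0 ∧ e • m ∈ diffLattice S := by
  constructor
  · intro hm
    by_contra! hne
    let D := AddSubgroup.toIntSubmodule (diffLattice S)
    let Q := M ⧸ D
    let q : M →ₗ[ℤ] Q ⧸ Submodule.torsion ℤ Q := (Submodule.mkQ _).comp (Submodule.mkQ D)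
    have hq : q m ≠ 0 := by
      intro h0
      obtain ⟨⟨e, he⟩, he'⟩ := Submodule.mem_torsion_iff _ |>.1
        ((Submodule.Quotient.mk_eq_zero (Submodule.torsion ℤ Q)).1 h0)
      have he0 : e ≠ 0 := nonZeroDivisors.ne_zero he
      have h1 : e • m ∈ diffLattice S := by
        have : Submodule.mkQ D (e • m) = 0 := by
          rw [map_smul]; exact he'
        exact (Submodule.Quotient.mk_eq_zero D).1 this
      refine hne e.natAbs (by omega) ?_
      rcases Int.natAbs_eq e with h2 | h2
      · rw [h2, natCast_zsmul] at h1; exact h1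
      · rw [h2, neg_smul, natCast_zsmul] at h1; exact neg_mem_iff.1 h1
    have : Module.Free ℤ (Q ⧸ Submodule.torsion ℤ Q) := inferInstance
    let b := Module.Free.chooseBasis ℤ (Q ⧸ Submodule.torsion ℤ Q)
    obtain ⟨i, hi⟩ : ∃ i, b.repr (q m) i ≠ 0 := by
      by_contra! h0
      exact hq (b.repr.map_eq_zero_iff.1 (Finsupp.ext h0))
    let c : M →ₗ[ℤ] ℝ := (Algebra.linearMap ℤ ℝ).comp ((b.coord i).comp q)
    let F : ℝ ⊗[ℤ] M →ₗ[ℝ] ℝ := LinearMap.liftBaseChange ℝ c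
    have hF : ∀ x, F ((1 : ℝ) ⊗ₜ x) = c x := fun x => by simp [F]
    have hker : Submodule.span ℝ ((fun m : M => (1 : ℝ) ⊗ₜ[ℤ] m) '' (S - S)) ≤
        LinearMap.ker F := by
      rw [Submodule.span_le]
      rintro _ ⟨x, hx, rfl⟩
      have hx0 : Submodule.mkQ D x = 0 :=
        (Submodule.Quotient.mk_eq_zero D).2 (AddSubgroup.subset_closure hx)
      rw [SetLike.mem_coe, LinearMap.mem_ker, hF]
      simp [c, q, hx0]
    have h3 : F ((1 : ℝ) ⊗ₜ m) = 0 := hker hm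
    rw [hF] at h3
    exact hi (by simpa [c] using h3)
  · rintro ⟨e, he, hm⟩
    have h1 : diffLattice S ≤ realSaturation S := by
      rw [diffLattice, AddSubgroup.closure_le]
      intro x hx
      exact Submodule.subset_span ⟨x, hx, rfl⟩
    have h2 : (1 : ℝ) ⊗ₜ[ℤ] (e • m) ∈
        Submodule.span ℝ ((fun m : M => (1 : ℝ) ⊗ₜ[ℤ] m) '' (S - S)) := h1 hm
    have h3 := Submodule.smul_mem _ ((e : ℝ)⁻¹) h2
    have h4 : (e : ℝ)⁻¹ • ((1 : ℝ) ⊗ₜ[ℤ] (e • m)) = (1 : ℝ) ⊗ₜ[ℤ] m := by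
      have he' : (e : ℝ) ≠ 0 := by exact_mod_cast he
      rw [TensorProduct.tmul_smul, ← Nat.cast_smul_eq_nsmul ℝ, smul_smul, inv_mul_cancel₀ he', one_smul]
    rw [h4] at h3
    exact h3

theorem diffLattice_le_realSaturation [Module.Finite ℤ M] (S : Set M) :
    diffLattice S ≤ realSaturation S := fun m hm =>
  mem_realSaturation_iff.2 ⟨1, one_ne_zero, by simpa using hm⟩

theorem exists_smul_mem_diffLattice [Module.Finite ℤ M] (S : Set M) :
    ∃ e : ℕ, e ≠ 0 ∧ ∀ m ∈ realSaturation S, e • m ∈ diffLattice S := by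
  classical
  obtain ⟨g, hg⟩ := IsNoetherian.noetherian (AddSubgroup.toIntSubmodule (realSaturation S))
  have hmem : ∀ x : g, (x : M) ∈ realSaturation S := fun x => by
    have : (x : M) ∈ AddSubgroup.toIntSubmodule (realSaturation S) :=
      hg ▸ Submodule.subset_span x.2
    exact this
  choose e he hem using fun x : g => mem_realSaturation_iff.1 (hmem x)
  refine ⟨∏ x, e x, Finset.prod_ne_zero_iff.2 fun x _ => he x, fun m hm => ?_⟩
  have hm' : m ∈ Submodule.span ℤ (g : Set M) := hg ▸ hm
  induction hm' using Submodule.span_induction with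
  | mem x hx =>
    obtain ⟨d, hd⟩ := Finset.dvd_prod_of_mem e (Finset.mem_univ (⟨x, hx⟩ : g))
    rw [hd, mul_comm, mul_smul]
    exact AddSubgroup.nsmul_mem _ (hem ⟨x, hx⟩) d
  | zero => simp
  | add x y hx hy h h' =>
    rw [smul_add]
    exact add_mem (h (hg ▸ hx : x ∈ AddSubgroup.toIntSubmodule (realSaturation S)))
      (h' (hg ▸ hy : y ∈ AddSubgroup.toIntSubmodule (realSaturation S)))
  | smul c x hx h =>
    rw [smul_comm]
    exact AddSubgroup.zsmul_mem _
      (h (hg ▸ hx : x ∈ AddSubgroup.toIntSubmodule (realSaturation S))) c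

/-- With finite generation this makes the quotient a free group, so that its torus is irreducible.
-/
theorem isTorsionFree_quotient_realSaturation [Module.Finite ℤ M] (S : Set M) :
    Module.IsTorsionFree ℤ (M ⧸ realSaturation S) := by
  refine Module.IsTorsionFree.of_smul_eq_zero fun c x hx => ?_
  obtain ⟨m, rfl⟩ := QuotientAddGroup.mk_surjective x
  refine or_iff_not_imp_left.2 fun hc => (QuotientAddGroup.eq_zero_iff m).2 ?_
  have h1 : c • m ∈ realSaturation S := (QuotientAddGroup.eq_zero_iff (c • m)).1 hx
  obtain ⟨e, he, hem⟩ := mem_realSaturation_iff.1 h1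
  refine mem_realSaturation_iff.2 ⟨e * c.natAbs, mul_ne_zero he (by omega), ?_⟩
  rw [mul_smul]
  rcases Int.natAbs_eq c with h2 | h2
  · rw [h2, natCast_zsmul] at hem; exact hem
  · rw [h2, neg_smul, natCast_zsmul, smul_neg] at hem; exact neg_mem_iff.1 hem

theorem finite_quotient_realSaturation [Module.Finite ℤ M] (S : Set M) :
    Module.Finite ℤ (M ⧸ realSaturation S) :=
  Module.Finite.of_surjective (QuotientAddGroup.mk' (realSaturation S)).toIntLinearMap
    (QuotientAddGroup.mk'_surjective _)

/-- The lattice `⟨S - S⟩` and its saturation have the same rank: one contains the other, and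
multiplication by a fixed `e` embeds the larger into the smaller. -/
theorem finrank_quotient_realSaturation [Module.Free ℤ M] [Module.Finite ℤ M] (S : Set M) :
    Module.finrank ℤ (M ⧸ realSaturation S) + Module.finrank ℤ (diffLattice S) =
      Module.finrank ℤ M := by
  let f := (QuotientAddGroup.mk' (realSaturation S)).toIntLinearMap
  have hmem : ∀ m, m ∈ LinearMap.ker f ↔ m ∈ realSaturation S := fun m =>
    QuotientAddGroup.eq_zero_iff m
  have h1 := (LinearMap.ker f).finrank_quotient_add_finrank
  rw [(f.quotKerEquivOfSurjective (QuotientAddGroup.mk'_surjective _)).finrank_eq] at h1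
  rw [← h1]
  congr 1
  let D := AddSubgroup.toIntSubmodule (diffLattice S)
  change Module.finrank ℤ D = _
  refine le_antisymm (Submodule.finrank_mono fun m hm =>
    (hmem m).2 (diffLattice_le_realSaturation S hm)) ?_
  obtain ⟨e, he, hem⟩ := exists_smul_mem_diffLattice S
  let g : LinearMap.ker f →ₗ[ℤ] D :=
    (((e : ℤ) • (LinearMap.id : M →ₗ[ℤ] M)).comp (LinearMap.ker f).subtype).codRestrict D
      fun m => by
        have h3 := hem m ((hmem m).1 m.2)
        rw [← natCast_zsmul] at h3
        exact h3
  refine LinearMap.finrank_le_finrank_of_injective (f := g) fun x y hxy => ?_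
  have h4 : (e : ℤ) • (x : M) = (e : ℤ) • (y : M) := congrArg Subtype.val hxy
  exact Subtype.ext (smul_right_injective M (by exact_mod_cast he : (e : ℤ) ≠ 0) h4)

theorem range_induced_mk' {k : Type*} [Field k] (H : AddSubgroup M) :
    Set.range (Torus.induced k (QuotientAddGroup.mk' H)) =
      {t | ∀ m ∈ H, Torus.monomial m t = 1} := by
  ext t
  constructor
  · rintro ⟨s, rfl⟩ m hm
    rw [Torus.monomial_induced, show QuotientAddGroup.mk' H m = 0 from
      (QuotientAddGroup.eq_zero_iff m).2 hm, Torus.monomial_zero]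
  · intro ht
    let t' : M →+ Additive kˣ := MonoidHom.toAdditiveRight t
    refine ⟨AddMonoidHom.toMultiplicativeLeft (QuotientAddGroup.lift H t' fun m hm => ?_), ?_⟩
    · apply Additive.toMul.injective
      exact Units.ext (ht m hm)
    · exact Torus.ext_monomial fun m => rfl

/-- The kernel of `T_M → T_{⟨S - S⟩}` is a finite union of cosets of the subtorus of the
saturation. -/
theorem exists_finite_cosets {k : Type*} [Field k] [Module.Finite ℤ M] (S : Set M) :
    ∃ R : Set (Torus k M), R.Finite ∧
      (∀ r ∈ R, ∀ m ∈ diffLattice S, Torus.monomial m r = 1) ∧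
      ∀ t : Torus k M, (∀ m ∈ diffLattice S, Torus.monomial m t = 1) →
        ∃ r ∈ R, ∃ t' : Torus k (M ⧸ realSaturation S),
          t = r * Torus.induced k (QuotientAddGroup.mk' (realSaturation S)) t' := by
  obtain ⟨g, hg⟩ := IsNoetherian.noetherian (AddSubgroup.toIntSubmodule (realSaturation S))
  obtain ⟨e, he, hem⟩ := exists_smul_mem_diffLattice S
  have hgmem : ∀ x ∈ g, x ∈ realSaturation S := fun x hx => by
    have : x ∈ AddSubgroup.toIntSubmodule (realSaturation S) := hg ▸ Submodule.subset_span hx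
    exact this
  let K : Set (Torus k M) := {t | ∀ m ∈ diffLattice S, Torus.monomial m t = 1}
  -- A kernel element takes values among the `e`-th roots of unity on the generators of the
  -- saturation, so there are finitely many value patterns. Two elements with the same pattern
  -- differ by an element of the subtorus.
  let ρ : Torus k M → (g → k) := fun t x => Torus.monomial (x : M) t
  have hfin : (ρ '' K).Finite := by
    have h1 : {z : k | z ^ e = 1}.Finite := by
      have h2 : (Polynomial.X ^ e - 1 : Polynomial k) ≠ 0 := by
        simpa using Polynomial.X_pow_sub_C_ne_zero (Nat.pos_of_ne_zero he) (1 : k)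
      refine (Polynomial.finite_setOfPred_isRoot h2).subset fun z hz => ?_
      have hz' : z ^ e = 1 := hz
      simp [hz']
    refine (Set.Finite.pi' fun _ : g => h1).subset ?_
    rintro _ ⟨t, ht, rfl⟩ x
    have h3 := ht _ (hem x (hgmem x x.2))
    rwa [Torus.monomial_nsmul] at h3
  obtain ⟨R, hRK, hR⟩ := Set.exists_subset_bijOn K ρ
  refine ⟨R, ?_, fun r hr => hRK hr, fun t ht => ?_⟩
  · exact Set.Finite.of_finite_image (hR.image_eq ▸ hfin) hR.injOn
  · obtain ⟨r, hr, hrt⟩ := hR.surjOn ⟨t, ht, rfl⟩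
    have h4 : r⁻¹ * t ∈ Set.range (Torus.induced k (QuotientAddGroup.mk' (realSaturation S))) := by
      rw [range_induced_mk']
      intro m hm
      have hm' : m ∈ Submodule.span ℤ (g : Set M) := hg ▸ hm
      clear hm
      induction hm' using Submodule.span_induction with
      | mem x hx =>
        have h5 : Torus.monomial x r = Torus.monomial x t := congrFun hrt ⟨x, hx⟩
        rw [Torus.monomial_mul, Torus.monomial_inv, h5,
          inv_mul_cancel₀ (Torus.monomial_ne_zero _ _)]
      | zero => simp
      | add x y _ _ hx hy => rw [Torus.monomial_add, hx, hy, mul_one]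
      | smul c x _ hx => rw [Torus.monomial_zsmul, hx, one_zpow]
    obtain ⟨t', ht'⟩ := h4
    exact ⟨r, hr, t', by rw [ht']; exact (mul_inv_cancel_left r t).symm⟩

end Saturation

/-! ### Monomial linear embeddings -/

section LinearEmbedding

variable {k : Type*} [Field k] {ι κ : Type*}

/-- The linear map `y ↦ (c_i y_{σ i})_i`. -/
def weightedPullback (c : ι → k) (σ : ι → κ) : (κ → k) →ₗ[k] (ι → k) where
  toFun y i := c i * y (σ i)
  map_add' y z := funext fun i => mul_add _ _ _
  map_smul' r y := funext fun i => by simp [mul_left_comm]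

theorem weightedPullback_injective {c : ι → k} {σ : ι → κ} (h : ∀ j, ∃ i, σ i = j ∧ c i ≠ 0) :
    Function.Injective (weightedPullback c σ) := by
  intro y z hyz
  funext j
  obtain ⟨i, rfl, hi⟩ := h j
  exact mul_left_cancel₀ hi (congrFun hyz i)

theorem map_weightedPullback_torusMap {L : Type*} [AddCommGroup L] [Nonempty κ] {c : ι → k}
    {σ : ι → κ} (h : ∀ j, ∃ i, σ i = j ∧ c i ≠ 0) (v : κ → L) (t : Torus k L) {x : ι → k}
    (hx : x ≠ 0) {a : k} (ha : ∀ i, x i = a * (c i * Torus.monomial (v (σ i)) t)) :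
    Projectivization.map (weightedPullback c σ) (weightedPullback_injective h) (torusMap k v t) =
      Projectivization.mk k x hx := by
  rw [torusMap, Projectivization.map_mk, Projectivization.mk_eq_mk_iff']
  have ha0 : a ≠ 0 := by
    rintro rfl
    exact hx (funext fun i => by simp [ha])
  refine ⟨a⁻¹, funext fun i => ?_⟩
  rw [Pi.smul_apply, smul_eq_mul, ha, inv_mul_cancel_left₀ ha0]
  rfl

theorem exists_projectiveEquivalence_of_map [Finite ι] [Nonempty ι] (R : (κ → k) →ₗ[k] (ι → k))
    (hR : Function.Injective R) {X : Set (ℙ k (ι → k))} {Y : Set (ℙ k (κ → k))}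
    (hXY : X = Projectivization.map R hR '' Y) :
    ∃ e : ProjectiveEquivalence X Y, ∀ y,
      Projectivization.map e.left e.left_injective (Projectivization.map R hR y) =
        Projectivization.map e.right e.right_injective y := by
  have hcard : Nat.card ι = (Nat.card ι - 1) + 1 := by
    have := Nat.card_pos (α := ι)
    omega
  let ε : (ι → k) ≃ₗ[k] (Fin (Nat.card ι - 1 + 1) → k) :=
    LinearEquiv.funCongrLeft k k (Finite.equivFinOfCardEq hcard).symm
  have hcomp : ∀ y, Projectivization.map ε.toLinearMap ε.injective (Projectivization.map R hR y) =
      Projectivization.map (ε.toLinearMap ∘ₗ R) (ε.injective.comp hR) y := by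
    intro y
    induction y using Projectivization.ind with
    | h v hv => rfl
  refine ⟨⟨Nat.card ι - 1, ε.toLinearMap, ε.toLinearMap ∘ₗ R, ε.injective, ε.injective.comp hR,
    ?_⟩, hcomp⟩
  rw [hXY, Set.image_image]
  exact Set.image_congr fun y _ => hcomp y

end LinearEmbedding

/-! ### The torus of a set of lattice points -/

section Orbit

variable {k : Type*} [Field k] {M : Type*} [AddCommGroup M]

theorem exists_sum_zero_of_affineSpan_eq_top {N : ℕ} {u : Fin (N + 1) → M}
    (h : affineSpan ℤ (Set.range u) = ⊤) (m : M) :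
    ∃ a : Fin (N + 1) → ℤ, ∑ i, a i = 0 ∧ ∑ i, a i • u i = m := by
  have hm : m + u 0 ∈ affineSpan ℤ (Set.range u) := h ▸ AffineSubspace.mem_top _ _ _
  obtain ⟨w, hw1, hw⟩ := eq_affineCombination_of_mem_affineSpan_of_fintype hm
  rw [Finset.affineCombination_eq_linear_combination _ _ _ hw1] at hw
  refine ⟨w - Pi.single 0 1, ?_, ?_⟩
  · simp [hw1]
  · simp [sub_smul, ← hw, Pi.single_apply]

theorem exists_sum_zero_diffLattice (S : Set M) [Fintype S] (b₀ : S) (m : diffLattice S) :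
    ∃ a : S → ℤ, ∑ b, a b = 0 ∧ ∑ b : S, a b • (⟨b.1 - b₀.1,
      AddSubgroup.subset_closure (Set.sub_mem_sub b.2 b₀.2)⟩ : diffLattice S) = m := by
  classical
  have key : ∀ x ∈ diffLattice S, ∃ a : S → ℤ, ∑ b, a b = 0 ∧ ∑ b : S, a b • (b.1 - b₀.1) = x := by
    intro x hx
    induction hx using AddSubgroup.closure_induction with
    | mem x hx =>
      obtain ⟨b, hb, b', hb', rfl⟩ := hx
      refine ⟨Pi.single ⟨b, hb⟩ 1 - Pi.single ⟨b', hb'⟩ 1, by simp, ?_⟩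
      simp [sub_smul, Pi.single_apply]
    | zero => exact ⟨0, by simp, by simp⟩
    | add x y _ _ hx hy =>
      obtain ⟨a, ha0, ha⟩ := hx
      obtain ⟨a', ha0', ha'⟩ := hy
      exact ⟨a + a', by simp [Finset.sum_add_distrib, ha0, ha0'],
        by simp only [Pi.add_apply, add_smul, Finset.sum_add_distrib, ha, ha']⟩
    | neg x _ hx =>
      obtain ⟨a, ha0, ha⟩ := hx
      exact ⟨-a, by simp [ha0], by simp only [Pi.neg_apply, neg_smul, Finset.sum_neg_distrib, ha]⟩
  obtain ⟨a, ha0, ha⟩ := key m.1 m.2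
  refine ⟨a, ha0, Subtype.ext ?_⟩
  rw [← ha]
  simp

theorem induced_subtype_surjective [IsAlgClosed k] (H : AddSubgroup M) :
    Function.Surjective (Torus.induced k H.subtype) := fun s =>
  exists_torus_comp_eq H.subtype s fun m hm => by
    rw [show m = 0 from Subtype.ext hm, Torus.monomial_zero]

theorem torusMap_eq_orbitMap (S : Set M) [Nonempty S] (b₀ : S) (t : Torus k M) :
    torusMap k (Subtype.val : S → M) t =
      orbitMap k S b₀ (Torus.induced k (diffLattice S).subtype t) := by
  rw [torusMap, orbitMap, Projectivization.mk_eq_mk_iff']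
  refine ⟨Torus.monomial b₀.1 t, funext fun b => ?_⟩
  rw [Pi.smul_apply, smul_eq_mul, Torus.monomial_induced, AddSubgroup.subtype_apply,
    Torus.monomial_sub, mul_div_cancel₀ _ (Torus.monomial_ne_zero _ _)]

/-- Shifting by `b₀` turns `X_S` into the toric variety of the points `b - b₀` of `⟨S - S⟩`, which
generate that lattice. The closure does not change, because `T_M` surjects onto `T_{⟨S-S⟩}`. -/
theorem isDenseOpenIn_orbitMap [IsAlgClosed k] (S : Set M) [Finite S] [Nonempty S] (b₀ : S) :
    IsDenseOpenIn (orbitMap k S b₀) (toricVarietyOfSet k S) := by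
  have := Fintype.ofFinite S
  have h := isDenseOpenIn_torusMap (k := k) (exists_sum_zero_diffLattice S b₀)
  have h1 : toricVarietyOfSet k S = toricVariety k (fun b : S => (⟨b.1 - b₀.1,
      AddSubgroup.subset_closure (Set.sub_mem_sub b.2 b₀.2)⟩ : diffLattice S)) := by
    refine congrArg closure (Set.Subset.antisymm ?_ ?_)
    · rintro _ ⟨t, rfl⟩
      exact ⟨_, (torusMap_eq_orbitMap S b₀ t).symm⟩
    · rintro _ ⟨t, rfl⟩
      obtain ⟨s, rfl⟩ := induced_subtype_surjective (k := k) (diffLattice S) t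
      exact ⟨s, torusMap_eq_orbitMap S b₀ s⟩
  rw [h1]
  exact h

end Orbit

/-! ### Dimension, tangent spaces and Gauss image of `X_A` -/

section Main

variable {k : Type*} [Field k] {M : Type*} [AddCommGroup M]
  {n N : ℕ} (β : Module.Basis (Fin n) ℤ M) {u : Fin (N + 1) → M}

theorem topologicalKrullDim_toricVariety [Infinite k] [Module.Free ℤ M] [Module.Finite ℤ M]
    (hu : ∀ m, ∃ a : Fin (N + 1) → ℤ, ∑ i, a i = 0 ∧ ∑ i, a i • u i = m) :
    topologicalKrullDim (toricVariety k u) = Module.finrank ℤ M := by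
  refine le_antisymm ?_ ?_
  · refine topologicalKrullDim_le_of_isInducing Topology.IsInducing.subtypeVal
      (fun _ : Unit => fun _ => (1 : k)) u fun x => ⟨(), closure_mono ?_ x.2⟩
    rintro _ ⟨t, rfl⟩
    obtain ⟨a, -, ha⟩ := exists_rep_torusMap u t
    exact ⟨t, a, fun i => by rw [ha, one_mul]⟩
  · have h := (isEmbedding_torusMap (k := k) hu).isInducing.codRestrict
      (s := toricVariety k u) fun t => subset_closure ⟨t, rfl⟩
    exact finrank_le_topologicalKrullDim_torus.trans h.topologicalKrullDim_le

/-- Equal row spaces have proportional Plücker vectors, so all `z^b` with `b ∈ B` change by one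
common factor, which cancels in the differences. The converse is the Cramer argument, applied in
both directions. -/
theorem embeddedTangentSpace_torusMap_eq_iff [Infinite k] [Module.Free ℤ M] [Module.Finite ℤ M]
    (hu : ∀ m, ∃ a : Fin (N + 1) → ℤ, ∑ i, a i = 0 ∧ ∑ i, a i • u i = m)
    (hn : Module.finrank ℤ M = n) (s t : Torus k M) :
    embeddedTangentSpace (toricVariety k u) (torusMap k u s) =
        embeddedTangentSpace (toricVariety k u) (torusMap k u t) ↔
      Torus.induced k (diffLattice (spanningSums k u n)).subtype s =
        Torus.induced k (diffLattice (spanningSums k u n)).subtype t := by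
  let β : Module.Basis (Fin n) ℤ M := Module.finBasisOfFinrankEq ℤ M hn
  rw [embeddedTangentSpace_torusMap β hu, embeddedTangentSpace_torusMap β hu,
    induced_subtype_eq_iff]
  constructor
  · intro h
    have h1 : ∀ a, ∃ c : Fin (n + 1) → k, ∑ b, c b • tangentRows β u t b = tangentRows β u s a :=
      fun a => (Submodule.mem_span_range_iff_exists_fun k).1
        (h ▸ Submodule.subset_span ⟨a, rfl⟩)
    choose C hC using h1
    have h2 := pluckerVector_mul (Matrix.of C) (tangentRows β u t)
    simp only [Matrix.of_apply, hC] at h2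
    have h3 : ∀ b ∈ spanningSums k u n,
        Torus.monomial b s = (Matrix.of C).det * Torus.monomial b t := by
      intro b hb
      obtain ⟨J, hJ, rfl⟩ := (mem_spanningSums β u).1 hb
      obtain ⟨I, hI, hIJ⟩ := exists_orderEmbedding_of_coordMinor_ne_zero β u hJ
      have h4 := congrFun h2 I
      rw [Pi.smul_apply, pluckerVector_tangentRows, pluckerVector_tangentRows, smul_eq_mul,
        ← mul_assoc, hIJ] at h4
      exact mul_right_cancel₀ hI h4
    intro b hb b' hb'
    have h5 : (Matrix.of C).det ≠ 0 := fun h0 =>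
      Torus.monomial_ne_zero b s (by rw [h3 b hb, h0, zero_mul])
    rw [Torus.monomial_sub, Torus.monomial_sub, h3 b hb, h3 b' hb', mul_div_mul_left _ _ h5]
  · intro h
    obtain ⟨I, hI⟩ := Function.ne_iff.1
      (pluckerVector_ne_zero (tangentRows_linearIndependent β hu t))
    rw [pluckerVector_tangentRows] at hI
    have hI' : coordMinor k β u I ≠ 0 := right_ne_zero_of_mul hI
    refine le_antisymm (Submodule.span_le.2 ?_) (Submodule.span_le.2 ?_)
    · rintro _ ⟨b, rfl⟩
      exact tangentRows_mem_span_of_monomial_eq β u h hI' b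
    · rintro _ ⟨b, rfl⟩
      exact tangentRows_mem_span_of_monomial_eq β u (fun b hb b' hb' => (h b hb b' hb').symm) hI' b

theorem exists_coordMinor_ne_zero
    (hu : ∀ m, ∃ a : Fin (N + 1) → ℤ, ∑ i, a i = 0 ∧ ∑ i, a i • u i = m) :
    ∃ I : Fin (n + 1) ↪o Fin (N + 1), coordMinor k β u I ≠ 0 := by
  obtain ⟨I, hI⟩ := Function.ne_iff.1
    (pluckerVector_ne_zero (tangentRows_linearIndependent β hu (1 : Torus k M)))
  rw [pluckerVector_tangentRows] at hI
  exact ⟨I, right_ne_zero_of_mul hI⟩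

theorem finrank_embeddedTangentSpace_torusMap [Infinite k] [Module.Free ℤ M] [Module.Finite ℤ M]
    (hu : ∀ m, ∃ a : Fin (N + 1) → ℤ, ∑ i, a i = 0 ∧ ∑ i, a i • u i = m)
    (hn : Module.finrank ℤ M = n) (t : Torus k M) :
    Module.finrank k (embeddedTangentSpace (toricVariety k u) (torusMap k u t)) = n + 1 := by
  let β : Module.Basis (Fin n) ℤ M := Module.finBasisOfFinrankEq ℤ M hn
  rw [embeddedTangentSpace_torusMap β hu,
    finrank_span_eq_card (tangentRows_linearIndependent β hu t), Fintype.card_fin]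

theorem torusMap_mem_smoothLocus [Infinite k] [Module.Free ℤ M] [Module.Finite ℤ M]
    (hu : ∀ m, ∃ a : Fin (N + 1) → ℤ, ∑ i, a i = 0 ∧ ∑ i, a i • u i = m) (t : Torus k M) :
    torusMap k u t ∈ smoothLocus (toricVariety k u) := by
  refine ⟨subset_closure ⟨t, rfl⟩, ?_⟩
  rw [topologicalKrullDim_toricVariety hu, finrank_embeddedTangentSpace_torusMap hu rfl t]
  norm_cast

/-- The closure of the image of the Gauss map is the image of `X_B` under a linear embedding,
compatibly with the maps from the torus. -/
theorem exists_linearMap_gaussImage [IsAlgClosed k] [Module.Free ℤ M] [Module.Finite ℤ M]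
    (hu : ∀ m, ∃ a : Fin (N + 1) → ℤ, ∑ i, a i = 0 ∧ ∑ i, a i • u i = m)
    (hn : Module.finrank ℤ M = n) [Nonempty (spanningSums k u n)]
    (hX : topologicalKrullDim (toricVariety k u) = n)
    (hφ : ∀ t, torusMap k u t ∈ smoothLocus (toricVariety k u)) :
    ∃ (R : (spanningSums k u n → k) →ₗ[k] ((Fin (n + 1) ↪o Fin (N + 1)) → k))
      (hR : Function.Injective R),
      gaussImage (toricVariety k u) hX =
        Projectivization.map R hR '' toricVarietyOfSet k (spanningSums k u n) ∧
      ∀ t, plucker (gaussMap (toricVariety k u) hX ⟨torusMap k u t, hφ t⟩) =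
        Projectivization.map R hR (torusMap k (Subtype.val : spanningSums k u n → M) t) := by
  classical
  have : Infinite k := IsAlgClosed.instInfinite
  let β : Module.Basis (Fin n) ℤ M := Module.finBasisOfFinrankEq ℤ M hn
  let B := spanningSums k u n
  have : Finite B := spanningSums_finite u
  have := Fintype.ofFinite B
  -- The arbitrary value is harmless: it is used only for vanishing minors, where the weight of the
  -- coordinate is 0.
  let σ : (Fin (n + 1) ↪o Fin (N + 1)) → B := fun I =>
    if h : coordMinor k β u I ≠ 0 then ⟨∑ j, u (I j), (mem_spanningSums β u).2 ⟨I, h, rfl⟩⟩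
    else Classical.arbitrary _
  have hσ : ∀ b : B, ∃ I, σ I = b ∧ coordMinor k β u I ≠ 0 := by
    rintro ⟨b, hb⟩
    obtain ⟨J, hJ, rfl⟩ := (mem_spanningSums β u).1 hb
    obtain ⟨I, hI, hIJ⟩ := exists_orderEmbedding_of_coordMinor_ne_zero β u hJ
    exact ⟨I, by simp only [σ, dif_pos hI, hIJ], hI⟩
  let R := weightedPullback (fun I : Fin (n + 1) ↪o Fin (N + 1) => coordMinor k β u I) σ
  have hR : Function.Injective R := weightedPullback_injective hσ
  have hmap : ∀ t, plucker (gaussMap (toricVariety k u) hX ⟨torusMap k u t, hφ t⟩) =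
      Projectivization.map R hR (torusMap k (Subtype.val : B → M) t) := by
    intro t
    have hmem : ∀ a, tangentRows β u t a ∈
        (gaussMap (toricVariety k u) hX ⟨torusMap k u t, hφ t⟩).1 := tangentRows_mem β t
    rw [plucker_eq_mk _ (tangentRows_linearIndependent β hu t) hmem]
    refine (map_weightedPullback_torusMap hσ _ t _ (a := 1) fun I => ?_).symm
    rw [pluckerVector_tangentRows, one_mul]
    by_cases hI : coordMinor k β u I = 0
    · simp [hI]
    · rw [mul_comm]
      simp only [σ, dif_pos hI]
  refine ⟨R, hR, ?_, hmap⟩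
  -- The range over all smooth points lies in the closure of the range over the torus.
  have h1 : gaussImage (toricVariety k u) hX = closure (Set.range fun t : Torus k M =>
      plucker (gaussMap (toricVariety k u) hX ⟨torusMap k u t, hφ t⟩)) := by
    refine Set.Subset.antisymm (closure_minimal ?_ isClosed_closure) (closure_mono ?_)
    · rintro _ ⟨y, rfl⟩
      have hY : Set.range (torusMap k u) ⊆ smoothLocus (toricVariety k u) := by
        rintro _ ⟨t, rfl⟩
        exact hφ t
      refine closure_mono ?_ (plucker_gaussMap_mem_closure hX subset_rfl hY y)
      rintro _ ⟨⟨_, t, rfl⟩, rfl⟩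
      exact ⟨t, rfl⟩
    · rintro _ ⟨t, rfl⟩
      exact ⟨_, rfl⟩
  rw [h1]
  change _ = Projectivization.map R hR '' closure (Set.range (torusMap k (Subtype.val : B → M)))
  rw [← closure_map_image, ← Set.range_comp]
  congr 2
  funext t
  exact hmap t

end Main

/-! ### Fibers of the Gauss map -/

section Fibers

variable {k : Type*} [Field k] {M : Type*} [AddCommGroup M] {n N : ℕ} {u : Fin (N + 1) → M}

theorem Torus.mul_assoc' (r s t : Torus k M) : r * s * t = r * (s * t) :=
  Torus.ext_monomial fun m => by simp only [Torus.monomial_mul, mul_assoc]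

theorem Torus.mul_inv_mul (s t : Torus k M) : s * (s⁻¹ * t) = t :=
  Torus.ext_monomial fun m => by
    rw [Torus.monomial_mul, Torus.monomial_mul, Torus.monomial_inv,
      mul_inv_cancel_left₀ (Torus.monomial_ne_zero _ _)]

theorem Torus.inv_mul_mul (s t : Torus k M) : s⁻¹ * (s * t) = t :=
  Torus.ext_monomial fun m => by
    rw [Torus.monomial_mul, Torus.monomial_mul, Torus.monomial_inv,
      inv_mul_cancel_left₀ (Torus.monomial_ne_zero _ _)]

theorem mul_image_range_induced_mk' (H : AddSubgroup M) (s : Torus k M) :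
    (fun t => s * t) '' Set.range (Torus.induced k (QuotientAddGroup.mk' H)) =
      {t | ∀ m ∈ H, Torus.monomial m t = Torus.monomial m s} := by
  rw [range_induced_mk']
  ext t
  constructor
  · rintro ⟨t, ht, rfl⟩ m hm
    rw [Torus.monomial_mul, ht m hm, mul_one]
  · intro ht
    refine ⟨s⁻¹ * t, fun m hm => ?_, Torus.mul_inv_mul s t⟩
    rw [Torus.monomial_mul, Torus.monomial_inv, ht m hm,
      inv_mul_cancel₀ (Torus.monomial_ne_zero _ _)]

theorem isClosed_mul_image_range_induced_mk' (H : AddSubgroup M) (s : Torus k M) :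
    IsClosed ((fun t => s * t) '' Set.range (Torus.induced k (QuotientAddGroup.mk' H))) := by
  rw [mul_image_range_induced_mk']
  simp only [Set.ofPred_forall]
  exact isClosed_biInter fun m _ => Torus.isClosed_monomial_eq_const m _

theorem embeddedTangentSpace_torusMap_mul_eq_iff [Infinite k] [Module.Free ℤ M]
    [Module.Finite ℤ M] (hu : ∀ m, ∃ a : Fin (N + 1) → ℤ, ∑ i, a i = 0 ∧ ∑ i, a i • u i = m)
    (hn : Module.finrank ℤ M = n) (s t : Torus k M) :
    embeddedTangentSpace (toricVariety k u) (torusMap k u (s * t)) =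
        embeddedTangentSpace (toricVariety k u) (torusMap k u s) ↔
      ∀ m ∈ diffLattice (spanningSums k u n), Torus.monomial m t = 1 := by
  rw [embeddedTangentSpace_torusMap_eq_iff hu hn]
  constructor
  · intro h m hm
    have h1 := congrArg (Torus.monomial (⟨m, hm⟩ : diffLattice (spanningSums k u n))) h
    change Torus.monomial m (s * t) = Torus.monomial m s at h1
    rw [Torus.monomial_mul] at h1
    exact mul_eq_left₀ (Torus.monomial_ne_zero _ _) |>.1 h1
  · intro h
    refine Torus.ext_monomial fun m => ?_
    change Torus.monomial m.1 (s * t) = Torus.monomial m.1 s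
    rw [Torus.monomial_mul, h m.1 m.2, mul_one]

/-- The closure of the image of a translate of `T_{M/H}` is projectively equivalent to the toric
variety of the image of `A` in `M/H`. -/
theorem projectivelyEquivalent_closure_image (H : AddSubgroup M) (s : Torus k M) :
    ProjectivelyEquivalent
      (closure (torusMap k u '' ((fun t => s * t) ''
        Set.range (Torus.induced k (QuotientAddGroup.mk' H)))))
      (toricVarietyOfSet k (Set.range fun i => QuotientAddGroup.mk' H (u i))) := by
  classical
  let S : Set (M ⧸ H) := Set.range fun i => QuotientAddGroup.mk' H (u i)
  -- Translation by `s` only rescales the coordinates. Points `u_i` with the same class modulo `H`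
  -- give repeated coordinates, which `σ` encodes.
  let c : Fin (N + 1) → k := fun i => Torus.monomial (u i) s
  let σ : Fin (N + 1) → S := fun i => ⟨QuotientAddGroup.mk' H (u i), i, rfl⟩
  have hσ : ∀ j, ∃ i, σ i = j ∧ c i ≠ 0 := by
    rintro ⟨_, i, rfl⟩
    exact ⟨i, rfl, Torus.monomial_ne_zero _ _⟩
  have hmap : ∀ t, torusMap k u (s * Torus.induced k (QuotientAddGroup.mk' H) t) =
      Projectivization.map (weightedPullback c σ) (weightedPullback_injective hσ)
        (torusMap k (Subtype.val : S → M ⧸ H) t) := fun t =>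
    (map_weightedPullback_torusMap hσ _ t _ (a := 1) fun i => by
      rw [Torus.monomial_mul, one_mul]
      rfl).symm
  have := Fintype.ofFinite S
  refine ⟨(exists_projectiveEquivalence_of_map (weightedPullback c σ)
    (weightedPullback_injective hσ) ?_).choose⟩
  change _ = Projectivization.map _ _ ''
    closure (Set.range (torusMap k (Subtype.val : S → M ⧸ H)))
  rw [← closure_map_image, ← Set.range_comp, ← Set.range_comp, ← Set.range_comp]
  exact congrArg closure (congrArg Set.range (funext hmap))

/-- The irreducible components of a coset of the kernel of `T_M → T_{⟨B - B⟩}` are translates of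
the subtorus of the quotient of `M` by the saturation of `⟨B - B⟩`. -/
theorem exists_eq_mul_image_of_mem_irreducibleComponents [Infinite k] [Module.Finite ℤ M]
    (B : Set M) {P : Torus k M → Prop}
    (hP : ∀ s t, P s → (P (s * t) ↔ ∀ m ∈ diffLattice B, Torus.monomial m t = 1))
    {C : Set {t // P t}} (hC : C ∈ irreducibleComponents {t // P t}) :
    ∃ s : Torus k M, Subtype.val '' C = (fun t => s * t) ''
      Set.range (Torus.induced k (QuotientAddGroup.mk' (realSaturation B))) := by
  classical
  have := isTorsionFree_quotient_realSaturation B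
  have := finite_quotient_realSaturation B
  obtain ⟨R, hRfin, hR1, hR⟩ := exists_finite_cosets (k := k) B
  obtain ⟨t₀, ht₀⟩ := hC.1.1
  let K : Torus k M → Set (Torus k M) := fun s => (fun t => s * t) ''
    Set.range (Torus.induced k (QuotientAddGroup.mk' (realSaturation B)))
  have hKP : ∀ r ∈ R, ∀ t, P (t₀.1 * r *
      Torus.induced k (QuotientAddGroup.mk' (realSaturation B)) t) := by
    intro r hr t
    rw [Torus.mul_assoc', hP _ _ t₀.2]
    intro m hm
    rw [Torus.monomial_mul, hR1 r hr m hm, one_mul]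
    exact (range_induced_mk' (realSaturation B)).subset ⟨t, rfl⟩ m
      (diffLattice_le_realSaturation B hm)
  let Z : Torus k M → Set {t // P t} := fun r => Subtype.val ⁻¹' K (t₀.1 * r)
  have hZirr : ∀ r ∈ R, IsIrreducible (Z r) := by
    intro r hr
    have hcont : Continuous fun t => (⟨_, hKP r hr t⟩ : {t // P t}) :=
      ((Torus.continuous_mul_left _).comp (Torus.continuous_induced _)).subtype_mk _
    have h := Torus.isIrreducible_univ.image _ hcont.continuousOn
    convert h using 1
    ext x
    constructor
    · rintro ⟨_, ⟨t, rfl⟩, ht⟩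
      exact ⟨t, trivial, Subtype.ext ht⟩
    · rintro ⟨t, -, rfl⟩
      exact ⟨_, ⟨t, rfl⟩, rfl⟩
  have hcover : C ⊆ ⋃₀ ((hRfin.toFinset.image Z : Finset (Set {t // P t})) :
      Set (Set {t // P t})) := by
    intro x _
    have hx : t₀.1 * (t₀.1⁻¹ * x.1) = x.1 := Torus.mul_inv_mul _ _
    obtain ⟨r, hr, t, ht⟩ := hR (t₀.1⁻¹ * x.1) ((hP t₀.1 _ t₀.2).1 (by rw [hx]; exact x.2))
    refine ⟨Z r, by simpa using ⟨r, hr, rfl⟩, ?_⟩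
    refine ⟨_, ⟨t, rfl⟩, ?_⟩
    rw [← hx, ht]
    exact Torus.mul_assoc' _ _ _
  obtain ⟨z, hz, hCz⟩ := isIrreducible_iff_sUnion_isClosed.1 hC.1 _ (by
    intro z hz
    obtain ⟨r, -, rfl⟩ := Finset.mem_image.1 hz
    exact (isClosed_mul_image_range_induced_mk' _ _).preimage continuous_subtype_val) hcover
  obtain ⟨r, hr, rfl⟩ := Finset.mem_image.1 hz
  rw [Set.Finite.mem_toFinset] at hr
  -- `C` lies in one of finitely many closed irreducible cosets, and its maximality gives equality.
  have hCZ : C = Z r := Set.Subset.antisymm hCz (hC.2 (hZirr r hr) hCz)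
  refine ⟨t₀.1 * r, ?_⟩
  rw [hCZ]
  refine (Subtype.image_preimage_coe _ _).trans ?_
  refine Set.inter_eq_right.2 ?_
  rintro _ ⟨_, ⟨t, rfl⟩, rfl⟩
  exact hKP r hr t

/-- For `s = 1` the composite is the torus map of the images of the `u_i`, which satisfy the
spanning condition in `M/H`; hence the inclusion of `T_{M/H}` is inducing. Translation by `s` is a
homeomorphism. -/
theorem isInducing_mul_induced_mk' (hu : ∀ m, ∃ a : Fin (N + 1) → ℤ, ∑ i, a i = 0 ∧
    ∑ i, a i • u i = m) (H : AddSubgroup M) (s : Torus k M) :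
    Topology.IsInducing fun t => torusMap k u (s * Torus.induced k (QuotientAddGroup.mk' H) t) := by
  have h1 : Topology.IsInducing (Torus.induced k (QuotientAddGroup.mk' H)) := by
    refine Topology.IsInducing.of_comp (Torus.continuous_induced _) (continuous_torusMap u) ?_
    refine (isEmbedding_torusMap (k := k) (v := fun i => QuotientAddGroup.mk' H (u i)) ?_).1
    intro m
    obtain ⟨m, rfl⟩ := QuotientAddGroup.mk'_surjective H m
    obtain ⟨a, ha0, rfl⟩ := hu m
    exact ⟨a, ha0, by simp⟩
  have h2 : Topology.IsInducing fun t : Torus k M => s * t := by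
    refine Topology.IsInducing.of_comp (Torus.continuous_mul_left s)
      (Torus.continuous_mul_left s⁻¹) ?_
    rw [show (fun t => s⁻¹ * t) ∘ (fun t : Torus k M => s * t) = id from
      funext fun t => Torus.inv_mul_mul s t]
    exact Topology.IsInducing.id
  exact (isEmbedding_torusMap hu).1.comp (h2.comp h1)

/-- Two points of a fiber of the Gauss map with the same nonvanishing coordinates differ by an
element of the torus that is trivial on `⟨B - B⟩`. -/
theorem exists_torus_of_embeddedTangentSpace_eq [IsAlgClosed k] [Module.Free ℤ M]
    [Module.Finite ℤ M] (hu : ∀ m, ∃ a : Fin (N + 1) → ℤ, ∑ i, a i = 0 ∧ ∑ i, a i • u i = m)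
    (hn : Module.finrank ℤ M = n) {t : Torus k M} {y y' : ℙ k (Fin (N + 1) → k)}
    (hy : y ∈ toricVariety k u) (hy' : y' ∈ toricVariety k u)
    (hT : embeddedTangentSpace (toricVariety k u) y =
      embeddedTangentSpace (toricVariety k u) (torusMap k u t))
    (hT' : embeddedTangentSpace (toricVariety k u) y' =
      embeddedTangentSpace (toricVariety k u) (torusMap k u t))
    (hyy' : ∀ i, y.rep i ≠ 0 ↔ y'.rep i ≠ 0) :
    ∃ (a : k) (τ : Torus k M), (∀ i, y'.rep i = a * Torus.monomial (u i) τ * y.rep i) ∧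
      ∀ m ∈ diffLattice (spanningSums k u n), Torus.monomial m τ = 1 := by
  have : Infinite k := IsAlgClosed.instInfinite
  obtain ⟨a, τ, ha, hτ⟩ := exists_torus_eq_of_mem_toricVariety hy
  obtain ⟨a', τ', ha', hτ'⟩ := exists_torus_eq_of_mem_toricVariety hy'
  have hrep : ∀ i, y'.rep i = a' / a * Torus.monomial (u i) (τ' * τ⁻¹) * y.rep i := by
    intro i
    by_cases hi : y.rep i = 0
    · have : y'.rep i = 0 := not_not.1 fun h => (hyy' i).2 h hi
      rw [hi, this, mul_zero]
    · rw [hτ' i ((hyy' i).1 hi), hτ i hi, Torus.monomial_mul, Torus.monomial_inv]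
      have := Torus.monomial_ne_zero (u i) τ
      field_simp
  refine ⟨a' / a, τ' * τ⁻¹, hrep, ?_⟩
  generalize τ' * τ⁻¹ = τ at hrep
  rw [← embeddedTangentSpace_torusMap_mul_eq_iff hu hn t τ]
  let W := embeddedTangentSpace (toricVariety k u) (torusMap k u t)
  -- The action of `τ` on vectors. It carries the tangent space at `y` into the one at `y'`, and
  -- both are `W`; it also carries the one at `t` into the one at `t * τ`. Dimensions turn these
  -- inclusions into equalities, so the tangent spaces at `t` and `t * τ` agree.
  let D := weightedPullback (fun i => Torus.monomial (u i) τ) (id : Fin (N + 1) → Fin (N + 1))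
  have hD : Function.Injective D :=
    weightedPullback_injective fun i => ⟨i, rfl, Torus.monomial_ne_zero _ _⟩
  have hDW : Module.finrank k (W.map D) = n + 1 :=
    (Submodule.equivMapOfInjective D hD W).finrank_eq.symm.trans
      (finrank_embeddedTangentSpace_torusMap hu hn t)
  have h1 : W.map D = W := by
    refine Submodule.eq_of_le_of_finrank_eq ?_
      (hDW.trans (finrank_embeddedTangentSpace_torusMap hu hn t).symm)
    rintro _ ⟨w, hw, rfl⟩
    have hw' : w ∈ embeddedTangentSpace (toricVariety k u) y := hT.symm ▸ hw
    exact hT'.le (mul_mem_embeddedTangentSpace hrep hw')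
  have h2 : W.map D = embeddedTangentSpace (toricVariety k u) (torusMap k u (t * τ)) := by
    refine Submodule.eq_of_le_of_finrank_eq ?_
      (hDW.trans (finrank_embeddedTangentSpace_torusMap hu hn _).symm)
    rintro _ ⟨w, hw, rfl⟩
    obtain ⟨b, hb, hb'⟩ := exists_rep_torusMap u t
    obtain ⟨c, -, hc'⟩ := exists_rep_torusMap u (t * τ)
    refine mul_mem_embeddedTangentSpace (c := c / b) (fun i => ?_) hw
    rw [hb', hc', Torus.monomial_mul]
    field_simp
  exact h2.symm.trans h1

theorem topologicalKrullDim_gaussMap_fiber [IsAlgClosed k] [Module.Free ℤ M]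
    [Module.Finite ℤ M] (hu : ∀ m, ∃ a : Fin (N + 1) → ℤ, ∑ i, a i = 0 ∧ ∑ i, a i • u i = m)
    (hn : Module.finrank ℤ M = n) (hX : topologicalKrullDim (toricVariety k u) = n)
    (hφ : ∀ t, torusMap k u t ∈ smoothLocus (toricVariety k u)) (t : Torus k M) :
    topologicalKrullDim {y : smoothLocus (toricVariety k u) |
      gaussMap (toricVariety k u) hX y = gaussMap (toricVariety k u) hX ⟨torusMap k u t, hφ t⟩} =
        Module.finrank ℤ (M ⧸ realSaturation (spanningSums k u n)) := by
  have : Infinite k := IsAlgClosed.instInfinite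
  let B := spanningSums k u n
  have := isTorsionFree_quotient_realSaturation B
  have := finite_quotient_realSaturation B
  let F := {y : smoothLocus (toricVariety k u) |
      gaussMap (toricVariety k u) hX y = gaussMap (toricVariety k u) hX ⟨torusMap k u t, hφ t⟩}
  let ind := Torus.induced k (QuotientAddGroup.mk' (realSaturation B))
  have hFT : ∀ y : F, embeddedTangentSpace (toricVariety k u) y.1.1 =
      embeddedTangentSpace (toricVariety k u) (torusMap k u t) := fun y =>
    congrArg Subtype.val y.2
  refine le_antisymm ?_ ?_
  · obtain ⟨R, hRfin, -, hR⟩ := exists_finite_cosets (k := k) B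
    have := hRfin.to_subtype
    -- The fiber may leave the torus, but only finitely many supports occur. Pairs of a support and
    -- a coset representative index finitely many monomial images that cover the fiber; the weights
    -- may vanish at some coordinates.
    let supp : F → Set (Fin (N + 1)) := fun y => {i | y.1.1.rep i ≠ 0}
    refine topologicalKrullDim_le_of_isInducing (T := F) (f := fun y => y.1.1)
      (Topology.IsInducing.subtypeVal.comp Topology.IsInducing.subtypeVal)
      (σ := Set.range supp × R)
      (fun p i => Torus.monomial (u i) p.2.1 * (Set.rangeSplitting supp p.1).1.1.rep i)
      (fun i => QuotientAddGroup.mk' (realSaturation B) (u i)) fun y => ?_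
    let y₀ := Set.rangeSplitting supp ⟨supp y, y, rfl⟩
    have hsupp : supp y₀ = supp y := Set.apply_rangeSplitting supp ⟨supp y, y, rfl⟩
    obtain ⟨a, τ, hτ, hτ1⟩ := exists_torus_of_embeddedTangentSpace_eq hu hn y₀.1.2.1 y.1.2.1
      (hFT y₀) (hFT y) fun i => Set.ext_iff.1 hsupp i
    obtain ⟨r, hr, t', rfl⟩ := hR τ hτ1
    refine ⟨(⟨supp y, y, rfl⟩, ⟨r, hr⟩), subset_closure ⟨t', a, fun i => ?_⟩⟩
    rw [hτ i, Torus.monomial_mul, Torus.monomial_induced]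
    change _ = a * (Torus.monomial (u i) r * y₀.1.1.rep i * _)
    ring
  -- Lower bound: the translate by `t` of the torus of the quotient embeds in the fiber.
  · refine finrank_le_topologicalKrullDim_torus.trans
      (Topology.IsInducing.topologicalKrullDim_le
        (f := fun t' => (⟨⟨torusMap k u (t * ind t'), hφ _⟩, Subtype.ext ?_⟩ : F)) ?_)
    · refine (embeddedTangentSpace_torusMap_mul_eq_iff hu hn t (ind t')).2 fun m hm => ?_
      exact (range_induced_mk' (realSaturation B)).subset ⟨t', rfl⟩ m
        (diffLattice_le_realSaturation B hm)
    · have h := isInducing_mul_induced_mk' (k := k) hu (realSaturation B) t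
      exact Topology.IsInducing.of_comp
        ((h.continuous.subtype_mk _).subtype_mk _)
        (continuous_subtype_val.comp continuous_subtype_val) h

end Fibers

end

end ToricGauss

theorem theorem1p1 {k : Type*} [Field k] [IsAlgClosed k]
    {M : Type*} [AddCommGroup M] [Module.Free ℤ M] [Module.Finite ℤ M]
    (n : ℕ) (hn : Module.finrank ℤ M = n)
    {N : ℕ} (u : Fin (N + 1) → M) (hu : Function.Injective u)
    (hspan : affineSpan ℤ (Set.range u) = ⊤) :
    let X : Set (ℙ k (Fin (N + 1) → k)) := toricVariety k u
    let φ : Torus k M → ℙ k (Fin (N + 1) → k) := torusMap k u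
    let B : Set M := spanningSums k u n
    let π : M →+ M ⧸ realSaturation B := QuotientAddGroup.mk' (realSaturation B)
    let res : Torus k M →* Torus k (diffLattice B) := Torus.induced k (diffLattice B).subtype
    -- `X_A` has dimension `n`, contains `T_M` as a dense open subset,
    -- and the Gauss map is defined on `T_M`
    ∃ (_ : Nonempty B) (hX : topologicalKrullDim X = n) (hφ : ∀ t, φ t ∈ smoothLocus X),
      IsDenseOpenIn φ X ∧
      -- (1) and (2): a projective equivalence of the closure of the image with `X_B`,
      -- under which the Gauss map on `T_M` is the surjection `T_M → T_{⟨B-B⟩} ⊆ X_B`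
      (∃ e : ProjectiveEquivalence (gaussImage X hX) (toricVarietyOfSet k B),
        Function.Surjective res ∧
        ∀ b₀ : B, IsDenseOpenIn (orbitMap k B b₀) (toricVarietyOfSet k B) ∧
          ∀ t : Torus k M,
            Projectivization.map e.left e.left_injective (plucker (gaussMap X hX ⟨φ t, hφ t⟩)) =
              Projectivization.map e.right e.right_injective (orbitMap k B b₀ (res t))) ∧
      -- (3): the irreducible components of the fibers of the Gauss map on `T_M`
      (∀ (W : Grassmannian k n N),
        ∀ C ∈ irreducibleComponents {t : Torus k M // gaussMap X hX ⟨φ t, hφ t⟩ = W},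
          (∃ s : Torus k M,
            Subtype.val '' C = (fun t => s * t) '' Set.range (Torus.induced k π)) ∧
          ProjectivelyEquivalent (closure (φ '' (Subtype.val '' C)))
            (toricVarietyOfSet k (Set.range fun i => π (u i)))) ∧
      -- the Gauss defect
      IsGaussDefect X hX (Module.finrank ℤ (M ⧸ realSaturation B)) ∧
      (Module.finrank ℤ (M ⧸ realSaturation B) : ℤ) =
        n - Module.finrank ℤ (diffLattice B) := by
  have : Infinite k := IsAlgClosed.instInfinite
  have hu' := exists_sum_zero_of_affineSpan_eq_top hspan
  intro X φ B π res
  let β : Module.Basis (Fin n) ℤ M := Module.finBasisOfFinrankEq ℤ M hn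
  obtain ⟨I, hI⟩ := exists_coordMinor_ne_zero (k := k) β hu'
  have hB : Nonempty B := ⟨⟨_, (mem_spanningSums β u).2 ⟨I, hI, rfl⟩⟩⟩
  have hI' : Nonempty (Fin (n + 1) ↪o Fin (N + 1)) := ⟨I⟩
  have hBfin : Finite B := spanningSums_finite u
  have hX : topologicalKrullDim X = n := hn ▸ topologicalKrullDim_toricVariety hu'
  have hφ : ∀ t, φ t ∈ smoothLocus X := torusMap_mem_smoothLocus hu'
  refine ⟨hB, hX, hφ, isDenseOpenIn_torusMap hu', ?_, ?_, ?_, ?_⟩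
  · obtain ⟨R, hR, hRX, hRφ⟩ := exists_linearMap_gaussImage hu' hn hX hφ
    obtain ⟨e, he⟩ := exists_projectiveEquivalence_of_map R hR hRX
    refine ⟨e, induced_subtype_surjective _, fun b₀ =>
      ⟨isDenseOpenIn_orbitMap B b₀, fun t => ?_⟩⟩
    rw [hRφ t, he, torusMap_eq_orbitMap B b₀]
  · intro W C hC
    obtain ⟨s, hs⟩ := exists_eq_mul_image_of_mem_irreducibleComponents B (fun s t hst => by
      subst hst
      exact Subtype.ext_iff.trans (embeddedTangentSpace_torusMap_mul_eq_iff hu' hn s t)) hC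
    exact ⟨⟨s, hs⟩, hs ▸ projectivelyEquivalent_closure_image _ s⟩
  -- Inside `X_A` this open set is exactly the torus.
  · refine ⟨{x | ∀ i, x.rep i ≠ 0}, isOpen_forall_rep_ne_zero, ?_, ?_⟩
    · rw [← range_torusMap]
      exact subset_rfl
    · intro x hx
      rw [← range_torusMap] at hx
      obtain ⟨t, rfl⟩ := hx
      exact ⟨hφ t, topologicalKrullDim_gaussMap_fiber hu' hn hX hφ t⟩
  · have h := finrank_quotient_realSaturation B
    omega
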